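/- \textbf{Setting.} Let $G$ be a complex simply connected semisimple algebraic group with root system $\Phi$, positive roots $\Phi^+$, cocharacter lattice $X^\vee$ (the coroot lattice) and apartment $\mathcal A=X^\vee\otimes\mathbb R$. For $\beta\in\Phi$, $m\in\mathbb Z$ let $H_{\beta,m}=\{x\in\mathcal A\mid\langle x,\beta\rangle=m\}$ and $s_{\beta,m}(x)=x-(\langle x,\beta\rangle-m)\beta^\vee$; let $W^{\mathfrak a}$ be the affine Weyl group, and $t_{\mu}$ the translation by $\mu$. Alcoves and faces are the closed ones of this hyperplane arrangement. A gallery joining $0$ with $\nu\in X^\vee$ is a sequence $\delta=(\{0\}=\Delta_0'\subset\Delta_0\supset\Delta_1'\subset\dots\supset\Delta_p'\subset\Delta_p\supset\Delta_{p+1}'=\{\nu\})$ of alcoves $\Delta_i$ and, for $1\le i\le p$, codimension-one faces $\Delta_i'$; we write $wt(\delta)=\nu$. Its type is the list of the $W^{\mathfrak a}$-orbit types of $\Delta_1',\dots,\Delta_p'$. A wall $H_{\beta,m}\supset\Delta_j'$ ($\beta\in\Phi^+$, $0\le j\le p$) is load-bearing at $\Delta_j$ if it separates $\Delta_j$ from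 some translate, by an element of $X^\vee$, of the anti-dominant chamber. Let $\lambda\in X^\vee$ be dominant and $\gamma_\lambda$ a gallery joining $0$ with $\lambda$ with the least possible number of alcoves. An LS-gallery of type $\gamma_\lambda$ is a gallery $\delta$ of the same type as $\gamma_\lambda$ which is positively folded (whenever $\Delta_{j-1}=\Delta_j$, $1\le j\le p$, the wall containing $\Delta_j'$ is load-bearing at $\Delta_j$) and for which the number of pairs ($j$, load-bearing wall at $\Delta_j$) equals $\langle\lambda+wt(\delta),\rho\rangle+\dim(P_\lambda/B)$. Here $\rho$ is half the sum of the positive roots, $B$ is the Borel subgroup, and $P_\lambda\supset B$ is the standard parabolic subgroup of the simple roots orthogonal to $\lambda$. Fix a simple root $\alpha$ and let $m_\delta$ be the least $m$ such that some $\Delta_k'$, $0\le k\le p+1$, lies in $H_{\alpha,m}$. \textbf{Root operators.} $e_\alpha\delta$ is defined if $m_\delta\le-1$. Then let $t$ be minimal with $\Delta_t'\subset H_{\alpha,m_\delta}$ and $s\le t$ maximal with $\Delta_s'\subset H_{\alpha,m_\delta+1}$; $e_\alpha\delta$ arises from $\delta$ by leaving the faces and alcoves with index $<s$ unchanged, applying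 $s_{\alpha,m_\delta+1}$ to those with index in $[s,t-1]$ and $t_{\alpha^\vee}$ to those with index $\ge t$. $f_\alpha\delta$ is defined if $\langle wt(\delta),\alpha\rangle-m_\delta\ge1$. Then let $j$ be maximal with $\Delta_j'\subset H_{\alpha,m_\delta}$ and $k\ge j$ minimal with $\Delta_k'\subset H_{\alpha,m_\delta+1}$; $f_\alpha\delta$ arises by leaving the faces and alcoves with index $<j$ unchanged, applying $s_{\alpha,m_\delta}$ to those with index in $[j,k-1]$ and $t_{-\alpha^\vee}$ to those with index $\ge k$. Let $\varepsilon_\alpha(\delta)$ (resp. $\varphi_\alpha(\delta)$) be the largest $n\ge 0$ such that $e_\alpha^n\delta$ (resp. $f_\alpha^n\delta$) is defined. \textbf{Sections.} $\Delta_k$ is $\alpha$-stable if there are $m\in\mathbb Z$ and $0\le l\le k<r\le p+1$ with $\Delta_l',\Delta_r'\subset H_{\alpha,m}$ and $\Delta_s'\not\subset H_{\alpha,m-1}$ for $l\le s<r$. For the least such $m$, let $r_\alpha(\Delta_k)$ be the least possible $r$ and $l_\alpha(\Delta_k)$ the largest possible $l$. For $0\le i<j\le p+1$, the interval $[i,j]$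 is (a) an $\alpha$-stable section if $i=l_\alpha(\Delta_k)$ and $j=r_\alpha(\Delta_k)$ for some $\alpha$-stable $\Delta_k$ with $i\le k<j$; (b) a $(\pm\alpha)$-directed section if no $\Delta_k$ with $i\le k<j$ is $\alpha$-stable and there is $m\in\mathbb Z$ such that, for all $k\in[i,j]$, $\Delta_k'\subset H_{\alpha,m}\Leftrightarrow k=i$ and $\Delta_k'\subset H_{\alpha,m\pm1}\Leftrightarrow k=j$. A partition of $\delta$ is a sequence $0=i_1<\dots<i_t=p+1$ such that every $[i_k,i_{k+1}]$ is a section of one of these three kinds. \textbf{Theorem.} Let $\delta$ be an LS-gallery of type $\gamma_\lambda$. Then $\delta$ has exactly one partition $i_1<\dots<i_t$, and each of its sections is of exactly one of the three kinds. Moreover: (1) If $e_\alpha\delta$ is defined, then $\delta$ has a $(-\alpha)$-directed section; let $[i_s,i_{s+1}]$ be the last one in the partition. The gallery $e_\alpha\delta=(\widetilde\Delta_0'\subset\widetilde\Delta_0\supset\dots)$ has the same unique partition $i_1<\dots<i_t$, and all sections are of the same kind for $e_\alpha\delta$ as for $\delta$, except that $[i_s,i_{s+1}]$ is $\alpha$-directed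 for $e_\alpha\delta$. Furthermore $\Delta_{i_{s+1}}'\subset H_{\alpha,m_\delta}$, and $\widetilde\Delta_j=\Delta_j$ for $j<i_s$, $\widetilde\Delta_j=s_{\alpha,m_\delta+1}\Delta_j$ for $i_s\le j<i_{s+1}$, $\widetilde\Delta_j=t_{\alpha^\vee}\Delta_j$ for $j\ge i_{s+1}$. (2) $\varepsilon_\alpha(\delta)$ is the number of $(-\alpha)$-directed sections in the partition of $\delta$. (3) If $f_\alpha\delta$ is defined, then $\delta$ has an $\alpha$-directed section; let $[i_s,i_{s+1}]$ be the first one in the partition. The gallery $f_\alpha\delta=(\widetilde\Delta_0'\subset\widetilde\Delta_0\supset\dots)$ has the same unique partition $i_1<\dots<i_t$, and all sections are of the same kind for $f_\alpha\delta$ as for $\delta$, except that $[i_s,i_{s+1}]$ is $(-\alpha)$-directed for $f_\alpha\delta$. Furthermore $\Delta_{i_s}'\subset H_{\alpha,m_\delta}$, and $\widetilde\Delta_j=\Delta_j$ for $j<i_s$, $\widetilde\Delta_j=s_{\alpha,m_\delta}\Delta_j$ for $i_s\le j<i_{s+1}$, $\widetilde\Delta_j=t_{-\alpha^\vee}\Delta_j$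 for $j\ge i_{s+1}$. (4) $\varphi_\alpha(\delta)$ is the number of $\alpha$-directed sections in the partition of $\delta$. -/

import Mathlib

/-!
Combinatorial galleries in the standard apartment of a complex simply connected semisimple group.
The group enters only through its root system.  A reduced crystallographic root system
`P : RootPairing ι ℝ M N` is used, `N` being the real span of the cocharacters (the apartment) and
`M` its dual; since the group is simply connected the cocharacter lattice is the coroot lattice.
-/

namespace LSGallery

open Module Set

variable {ι M N : Type*} [AddCommGroup M] [Module ℝ M] [AddCommGroup N] [Module ℝ N]

section Apartment

variable (P : RootPairing ι ℝ M N)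

/-- The cocharacter lattice (coroot lattice) inside the apartment. -/
def cocharLattice : Submodule ℤ N := Submodule.span ℤ (range P.coroot)

/-- The affine hyperplane `⟨x, β⟩ = m` for the root `β` with index `i`. -/
def hyperplane (i : ι) (m : ℤ) : Set N := {x | P.root' i x = m}

/-- The closed half-space `⟨x, β⟩ ≥ m`. -/
def upperHalf (i : ι) (m : ℤ) : Set N := {x | (m : ℝ) ≤ P.root' i x}

/-- The closed half-space `⟨x, β⟩ ≤ m`. -/
def lowerHalf (i : ι) (m : ℤ) : Set N := {x | P.root' i x ≤ m}

/-- The affine reflection `x ↦ x - (⟨x, β⟩ - m) β^∨`. -/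
noncomputable def affineReflection (i : ι) (m : ℤ) : N ≃ᵃ[ℝ] N :=
  (P.coreflection i).toAffineEquiv.trans (AffineEquiv.constVAdd ℝ N ((m : ℝ) • P.coroot i))

theorem affineReflection_apply (i : ι) (m : ℤ) (x : N) :
    affineReflection P i m x = x - (P.root' i x - m) • P.coroot i := by
  simp only [affineReflection, AffineEquiv.trans_apply, LinearEquiv.coe_toAffineEquiv,
    AffineEquiv.constVAdd_apply, vadd_eq_add, P.coreflection_apply]
  module

/-- The affine Weyl group, generated by all affine reflections (it is the semidirect product of
the finite Weyl group with the coroot lattice). -/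
def affineWeylGroup : Subgroup (N ≃ᵃ[ℝ] N) :=
  Subgroup.closure {s | ∃ (i : ι) (m : ℤ), s = affineReflection P i m}

variable {P} (b : P.Base)

/-- The union of all affine reflection hyperplanes. -/
def hyperplaneUnion : Set N := ⋃ (i : ι) (_ : b.IsPos i) (m : ℤ), hyperplane P i m

/-- Closed alcoves: closures of the connected components of the complement of the hyperplanes. -/
def IsAlcove [TopologicalSpace N] (D : Set N) : Prop :=
  ∃ x ∈ (hyperplaneUnion b)ᶜ, D = closure (connectedComponentIn (hyperplaneUnion b)ᶜ x)

/-- `H^+`, `H^-` or `H` itself, according to the sign. -/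
def signedPart (P : RootPairing ι ℝ M N) : SignType → ι → ℤ → Set N
  | .pos, i, m => upperHalf P i m
  | .neg, i, m => lowerHalf P i m
  | .zero, i, m => hyperplane P i m

/-- (Closed, non-empty) faces. -/
def IsFace (F : Set N) : Prop :=
  F.Nonempty ∧ ∃ ε : ι → ℤ → SignType,
    F = ⋂ (i : ι) (_ : b.IsPos i) (m : ℤ), signedPart P (ε i m) i m

/-- `F` has codimension one in the apartment. -/
def HasCodimOne (F : Set N) : Prop := finrank ℝ (vectorSpan ℝ F) + 1 = finrank ℝ N

/-- The fundamental alcove. -/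
def fundAlcove : Set N := {x | ∀ i, b.IsPos i → 0 ≤ P.root' i x ∧ P.root' i x ≤ 1}

/-- The closed anti-dominant chamber. -/
def antidominantChamber : Set N := {x | ∀ i, b.IsPos i → P.root' i x ≤ 0}

/-- The simple affine reflections: reflections in the walls of the fundamental alcove. -/
def simpleAffineReflections : Set (N ≃ᵃ[ℝ] N) :=
  {s | ∃ (i : ι) (m : ℤ), b.IsPos i ∧ s = affineReflection P i m ∧
    ∃ F, IsFace b F ∧ HasCodimOne F ∧ F ⊆ fundAlcove b ∧ F ⊆ hyperplane P i m}

/-- The type of a face `F`: the set of all simple affine reflections whose hyperplane contains the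
face of the fundamental alcove lying in the orbit of `F` under the affine Weyl group. -/
def faceType (F : Set N) : Set (N ≃ᵃ[ℝ] N) :=
  {s | s ∈ simpleAffineReflections b ∧ ∃ (i : ι) (m : ℤ), b.IsPos i ∧
    s = affineReflection P i m ∧ ∃ w ∈ affineWeylGroup P,
      w '' F ⊆ fundAlcove b ∧ w '' F ⊆ hyperplane P i m}

variable (P) in
/-- The hyperplane `H_{β,m}` separates `D` from the chamber `C`: for some translation in the affine
Weyl group, `D` and the translate of `C` lie on different sides of it. -/
def Separates (i : ι) (m : ℤ) (D C : Set N) : Prop :=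
  ∃ μ ∈ cocharLattice P,
    (D ⊆ upperHalf P i m ∧ (fun x => μ + x) '' C ⊆ lowerHalf P i m) ∨
    (D ⊆ lowerHalf P i m ∧ (fun x => μ + x) '' C ⊆ upperHalf P i m)

/-- Dominant cocharacters. -/
def IsDominant (x : N) : Prop := x ∈ cocharLattice P ∧ ∀ i, b.IsPos i → 0 ≤ P.root' i x

end Apartment

section Galleries

/-- The data of a sequence
`face 0 ⊂ alcove 0 ⊃ face 1 ⊂ ... ⊃ face len ⊂ alcove len ⊃ face (len + 1) = {wt}`.
Only `face k` for `k ≤ len + 1` and `alcove k` for `k ≤ len` are meaningful. -/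
structure GalleryData (N : Type*) where
  /-- The index of the last alcove. -/
  len : ℕ
  /-- The small faces. -/
  face : ℕ → Set N
  /-- The alcoves. -/
  alcove : ℕ → Set N
  /-- The end point. -/
  wt : N

variable {P : RootPairing ι ℝ M N} (b : P.Base)

/-- `γ` is a combinatorial gallery joining `0` with `γ.wt`. -/
structure IsGallery [TopologicalSpace N] (γ : GalleryData N) : Prop where
  face_zero : γ.face 0 = {0}
  face_last : γ.face (γ.len + 1) = {γ.wt}
  wt_mem : γ.wt ∈ cocharLattice P
  isAlcove : ∀ k ≤ γ.len, IsAlcove b (γ.alcove k)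
  face_subset : ∀ k ≤ γ.len, γ.face k ⊆ γ.alcove k
  face_succ_subset : ∀ k ≤ γ.len, γ.face (k + 1) ⊆ γ.alcove k
  isFace : ∀ k, 1 ≤ k → k ≤ γ.len → IsFace b (γ.face k) ∧ HasCodimOne (γ.face k)

/-- The two galleries have the same type. -/
def SameType (γ δ : GalleryData N) : Prop :=
  γ.len = δ.len ∧ ∀ k, 1 ≤ k → k ≤ γ.len → faceType b (γ.face k) = faceType b (δ.face k)

/-- `γ` is a gallery joining `0` with `lam` that has the least possible number of alcoves. -/
def IsMinimalGallery [TopologicalSpace N] (lam : N) (γ : GalleryData N) : Prop :=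
  IsGallery b γ ∧ γ.wt = lam ∧
    ∀ γ' : GalleryData N, IsGallery b γ' → γ'.wt = lam → γ.len ≤ γ'.len

/-- `H_{β,m}`, `β` the positive root with index `i`, is a load-bearing wall of `δ` at alcove `k`. -/
def IsLoadBearing (δ : GalleryData N) (i : ι) (m : ℤ) (k : ℕ) : Prop :=
  b.IsPos i ∧ k ≤ δ.len ∧ δ.face k ⊆ hyperplane P i m ∧
    Separates P i m (δ.alcove k) (antidominantChamber b)

/-- All foldings of `δ` are positive. -/
def IsPositivelyFolded (δ : GalleryData N) : Prop :=
  ∀ k, 1 ≤ k → k ≤ δ.len → δ.alcove (k - 1) = δ.alcove k →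
    ∀ (i : ι) (m : ℤ), b.IsPos i → δ.face k ⊆ hyperplane P i m →
      Separates P i m (δ.alcove k) (antidominantChamber b)

/-- The number of pairs of a load-bearing wall and an alcove of `δ` at which it is load-bearing. -/
noncomputable def galleryDim (δ : GalleryData N) : ℕ :=
  {q : (ι × ℤ) × ℕ | IsLoadBearing b δ q.1.1 q.1.2 q.2}.ncard

/-- `⟨x, ρ⟩` with `ρ` half the sum of the positive roots. -/
noncomputable def rhoPairing (x : N) : ℝ :=
  (1 / 2) * ∑ᶠ (i : ι) (_ : b.IsPos i), P.root' i x

/-- The dimension of `P_J / B` for the set `J` of simple roots orthogonal to `lam`: the number of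
positive roots that are integral combinations of the simple roots in `J`. -/
noncomputable def parabolicDim (lam : N) : ℕ :=
  {i : ι | b.IsPos i ∧
    P.root i ∈ Submodule.span ℤ (P.root '' {j | j ∈ b.support ∧ P.root' j lam = 0})}.ncard

/-- `δ` is an LS-gallery of the type of `γ` (a minimal gallery joining `0` with `lam`). -/
structure IsLSGallery [TopologicalSpace N] (lam : N) (γ δ : GalleryData N) : Prop where
  isGallery : IsGallery b δ
  sameType : SameType b γ δ
  positivelyFolded : IsPositivelyFolded b δ
  dim_eq : (galleryDim b δ : ℝ) = rhoPairing b (lam + δ.wt) + parabolicDim b lam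

end Galleries

section RootOperators

variable (P : RootPairing ι ℝ M N) (a : ι)

/-- The least `m` such that some small face of `δ` lies in `H_{α,m}`. -/
noncomputable def minHeight (δ : GalleryData N) : ℤ :=
  sInf {m | ∃ k ≤ δ.len + 1, δ.face k ⊆ hyperplane P a m}

/-- `e_α δ` is defined. -/
def EDefined (δ : GalleryData N) : Prop := minHeight P a δ ≤ -1

/-- The first index of a small face in the hyperplane `H_{α,m}` of least height `m`. -/
noncomputable def eEnd (δ : GalleryData N) : ℕ :=
  sInf {k | k ≤ δ.len + 1 ∧ δ.face k ⊆ hyperplane P a (minHeight P a δ)}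

/-- The last index before that of a small face in `H_{α,m+1}`. -/
noncomputable def eStart (δ : GalleryData N) : ℕ :=
  sSup {k | k ≤ eEnd P a δ ∧ δ.face k ⊆ hyperplane P a (minHeight P a δ + 1)}

/-- The map that `e_α` applies to the `k`-th small face and the `k`-th alcove. -/
noncomputable def eMap (δ : GalleryData N) (k : ℕ) : N → N :=
  if k < eStart P a δ then id
  else if k < eEnd P a δ then affineReflection P a (minHeight P a δ + 1)
  else fun x => x + P.coroot a

/-- The operator `e_α` (meaningful if `EDefined P a δ`). -/
noncomputable def eOp (δ : GalleryData N) : GalleryData N where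
  len := δ.len
  face k := eMap P a δ k '' δ.face k
  alcove k := eMap P a δ k '' δ.alcove k
  wt := δ.wt + P.coroot a

/-- `f_α δ` is defined. -/
def FDefined (δ : GalleryData N) : Prop := 1 ≤ P.root' a δ.wt - minHeight P a δ

/-- The last index of a small face in the hyperplane `H_{α,m}` of least height `m`. -/
noncomputable def fStart (δ : GalleryData N) : ℕ :=
  sSup {k | k ≤ δ.len + 1 ∧ δ.face k ⊆ hyperplane P a (minHeight P a δ)}

/-- The first index after that of a small face in `H_{α,m+1}`. -/
noncomputable def fEnd (δ : GalleryData N) : ℕ :=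
  sInf {k | fStart P a δ ≤ k ∧ k ≤ δ.len + 1 ∧
    δ.face k ⊆ hyperplane P a (minHeight P a δ + 1)}

/-- The map that `f_α` applies to the `k`-th small face and the `k`-th alcove. -/
noncomputable def fMap (δ : GalleryData N) (k : ℕ) : N → N :=
  if k < fStart P a δ then id
  else if k < fEnd P a δ then affineReflection P a (minHeight P a δ)
  else fun x => x - P.coroot a

/-- The operator `f_α` (meaningful if `FDefined P a δ`). -/
noncomputable def fOp (δ : GalleryData N) : GalleryData N where
  len := δ.len
  face k := fMap P a δ k '' δ.face k
  alcove k := fMap P a δ k '' δ.alcove k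
  wt := δ.wt - P.coroot a

/-- `e_α^n δ` is defined. -/
def EIterDefined : ℕ → GalleryData N → Prop
  | 0, _ => True
  | n + 1, δ => EDefined P a δ ∧ EIterDefined n (eOp P a δ)

/-- `f_α^n δ` is defined. -/
def FIterDefined : ℕ → GalleryData N → Prop
  | 0, _ => True
  | n + 1, δ => FDefined P a δ ∧ FIterDefined n (fOp P a δ)

end RootOperators

section Sections

variable (P : RootPairing ι ℝ M N) (a : ι) (δ : GalleryData N)

/-- The indices `l ≤ k < r` show that the `k`-th alcove is `α`-stable, by means of `H_{α,m}`. -/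
def StableWitness (k : ℕ) (m : ℤ) (l r : ℕ) : Prop :=
  l ≤ k ∧ k < r ∧ r ≤ δ.len + 1 ∧
    δ.face r ⊆ hyperplane P a m ∧ δ.face l ⊆ hyperplane P a m ∧
    ∀ s, l ≤ s → s < r → ¬ δ.face s ⊆ hyperplane P a (m - 1)

/-- The `k`-th alcove is `α`-stable. -/
def IsStable (k : ℕ) : Prop := ∃ m l r, StableWitness P a δ k m l r

/-- The `k`-th alcove is `α`-stable at `m`. -/
def IsStableAt (k : ℕ) (m : ℤ) : Prop := IsLeast {m | ∃ l r, StableWitness P a δ k m l r} m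

/-- The three kinds of sections. -/
inductive SectionKind
  | directed
  | antidirected
  | stable

/-- `[i, j]` is an `α`-directed section (`d = 1`) or a `(-α)`-directed section (`d = -1`). -/
def IsDirectedSection (d : ℤ) (i j : ℕ) : Prop :=
  i < j ∧ j ≤ δ.len + 1 ∧
    (∃ m : ℤ, ∀ k, i ≤ k → k ≤ j →
      (δ.face k ⊆ hyperplane P a m ↔ k = i) ∧ (δ.face k ⊆ hyperplane P a (m + d) ↔ k = j)) ∧
    ∀ k, i ≤ k → k < j → ¬ IsStable P a δ k

/-- `[i, j]` is an `α`-stable section: for some alcove `k` in it, `α`-stable at `m`, the index `j`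
is the least possible right index and `i` the largest possible left index. -/
def IsStableSection (i j : ℕ) : Prop :=
  ∃ k m, i ≤ k ∧ k < j ∧ IsStableAt P a δ k m ∧
    IsLeast {r | ∃ l, StableWitness P a δ k m l r} j ∧
    IsGreatest {l | ∃ r, StableWitness P a δ k m l r} i

/-- `[i, j]` is a section of the given kind. -/
def IsSection : SectionKind → ℕ → ℕ → Prop
  | .directed, i, j => IsDirectedSection P a δ 1 i j
  | .antidirected, i, j => IsDirectedSection P a δ (-1) i j
  | .stable, i, j => IsStableSection P a δ i j

/-- `i < j` are consecutive elements of `S`. -/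
def IsConsecutive (S : Finset ℕ) (i j : ℕ) : Prop :=
  i ∈ S ∧ j ∈ S ∧ i < j ∧ ∀ k ∈ S, ¬ (i < k ∧ k < j)

/-- The elements `0 = i_1 < i_2 < ... < i_t = len + 1` of `S` partition `δ` into sections. -/
def IsSectionPartition (S : Finset ℕ) : Prop :=
  0 ∈ S ∧ δ.len + 1 ∈ S ∧ (∀ k ∈ S, k ≤ δ.len + 1) ∧
    ∀ i j, IsConsecutive S i j → ∃ T, IsSection P a δ T i j

/-- The number of sections of the given kind in the partition `S`. -/
noncomputable def sectionCount (S : Finset ℕ) (T : SectionKind) : ℕ :=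
  {q : ℕ × ℕ | IsConsecutive S q.1 q.2 ∧ IsSection P a δ T q.1 q.2}.ncard

end Sections

end LSGallery

/-! Only the heights matter: the integers `m` with `Δ_k' ⊂ H_{α,m}`, where they exist. They start at
`0` and end at `⟨wt, α⟩`. Consecutive ones differ by at most one, because between them the alcoves
stay in one strip between adjacent walls `H_{α,c}`, `H_{α,c+1}`. So heights satisfy an intermediate
value theorem (`IsGallery.isHeightPath`, `exists_between_of_step`).

Stability of an alcove is inherited by its whole minimal interval (`stable_interval_spec`), and an
unstable alcove lies in a step between two consecutive heights that differ by exactly one. Hence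
each alcove lies in exactly one section, of exactly one kind, which gives the unique partition
(`exists_isSection`, `isSection_eq_of_overlap`).

An unstable descent from `x` to `x - 1` has no height below `x` before it, and an unstable ascent
from `x` to `x + 1` has no height below `x + 1` after it (`le_of_antidirected`, `le_of_directed`).
So the last `(-α)`-directed section is the first arrival at `m_δ`, and the first `α`-directed
section is the last departure from `m_δ`. These are the steps that `e_α` and `f_α` reverse. The
heights before the step are kept and those after it are shifted by `±2`. The step is unstable before
and after, so no interval witnessing stability contains it, and all other sections survive
(`IsHeightShift`). Counting the sections by induction gives `ε_α` and `φ_α`. -/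

namespace LSGallery

open Module Set

/-! ### Affine automorphisms of the apartment and their action on faces and alcoves. -/

section ApartmentAutomorphisms

variable {ι M N : Type*} [AddCommGroup M] [Module ℝ M] [AddCommGroup N] [Module ℝ N]
variable {P : RootPairing ι ℝ M N} {b : P.Base}

theorem root'_reflectionPerm (i j : ι) (x : N) :
    P.root' (P.reflectionPerm i j) x = P.root' j x - P.pairing j i * P.root' i x := by
  simp only [RootPairing.root', RootPairing.root_reflectionPerm, RootPairing.reflection_apply_root,
    map_sub, map_smul, LinearMap.sub_apply, LinearMap.smul_apply, smul_eq_mul]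

theorem root'_reflectionPerm_self (i : ι) (x : N) :
    P.root' (P.reflectionPerm i i) x = - P.root' i x := by
  rw [root'_reflectionPerm, P.pairing_same]
  ring

theorem isPos_or_isPos_reflectionPerm [Finite ι] [P.IsCrystallographic] [P.IsReduced] (b : P.Base)
    (i : ι) : b.IsPos i ∨ b.IsPos (P.reflectionPerm i i) :=
  RootPairing.Base.IsPos.or_neg b i

theorem signedPart_neg (e : SignType) (i : ι) (m : ℤ) :
    signedPart P (-e) (P.reflectionPerm i i) (-m) = signedPart P e i m := by
  have h := root'_reflectionPerm_self (P := P) i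
  ext x
  cases e
  · change P.root' (P.reflectionPerm i i) x = ((-m : ℤ) : ℝ) ↔ P.root' i x = (m : ℝ)
    rw [h]; push_cast; exact neg_inj
  · change ((-m : ℤ) : ℝ) ≤ P.root' (P.reflectionPerm i i) x ↔ P.root' i x ≤ (m : ℝ)
    rw [h]; push_cast; exact neg_le_neg_iff
  · change P.root' (P.reflectionPerm i i) x ≤ ((-m : ℤ) : ℝ) ↔ (m : ℝ) ≤ P.root' i x
    rw [h]; push_cast; exact neg_le_neg_iff

/-- Any two different conditions on one wall leave only the wall itself, which is sign `0`. This
merges the conditions that `β` and `-β` impose on the same wall. -/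
theorem signedPart_inter (d e : SignType) (i : ι) (m : ℤ) :
    signedPart P (if d = e then d else 0) i m = signedPart P d i m ∩ signedPart P e i m := by
  have key : ∀ x : N, (x ∈ hyperplane P i m ↔ x ∈ upperHalf P i m ∧ x ∈ lowerHalf P i m) := by
    intro x
    simp only [hyperplane, upperHalf, lowerHalf, mem_ofPred_eq]
    constructor
    · intro h; exact ⟨h.ge, h.le⟩
    · rintro ⟨h, h'⟩; exact le_antisymm h' h
  ext x
  have := key x
  cases d <;> cases e <;> simp [signedPart] <;> tauto

/-- Faces may be described by sign conditions on all roots instead of the positive ones. -/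
theorem isFace_iff [Finite ι] [P.IsCrystallographic] [P.IsReduced] {F : Set N} :
    IsFace b F ↔ F.Nonempty ∧ ∃ ε : ι → ℤ → SignType,
      F = {x | ∀ i m, x ∈ signedPart P (ε i m) i m} := by
  classical
  refine and_congr_right fun _ => ⟨?_, ?_⟩
  · rintro ⟨ε, rfl⟩
    refine ⟨fun i m => if b.IsPos i then ε i m else -ε (P.reflectionPerm i i) (-m), ?_⟩
    ext x
    simp only [mem_iInter, mem_ofPred_eq]
    constructor
    · intro h i m
      by_cases hi : b.IsPos i
      · rw [if_pos hi]; exact h i hi m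
      · rw [if_neg hi, ← signedPart_neg, neg_neg]
        exact h _ ((isPos_or_isPos_reflectionPerm b i).resolve_left hi) _
    · intro h i hi m
      have := h i m
      rwa [if_pos hi] at this
  · rintro ⟨ε, rfl⟩
    -- The wall `H_{β,m}` is also `H_{-β,-m}`, with its sides exchanged; the sign chosen here
    -- encodes both conditions at once.
    refine ⟨fun i m => if ε i m = -ε (P.reflectionPerm i i) (-m) then ε i m else 0, ?_⟩
    ext x
    simp only [mem_iInter, mem_ofPred_eq, signedPart_inter, mem_inter_iff]
    constructor
    · intro h i _ m
      refine ⟨h i m, ?_⟩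
      rw [← signedPart_neg, neg_neg]
      exact h _ _
    · intro h i m
      rcases isPos_or_isPos_reflectionPerm b i with hi | hi
      · exact (h i hi m).1
      · have h2 := (h _ hi (-m)).2
        rw [neg_neg] at h2
        have h3 : P.reflectionPerm (P.reflectionPerm i i) (P.reflectionPerm i i) = i :=
          letI := P.indexNeg
          neg_neg i
        rwa [h3, ← signedPart_neg, neg_neg, h3, neg_neg] at h2

/-- Affine automorphisms of the apartment that permute the affine root hyperplanes, compatibly
with the orientation of the roots. -/
def IsApartmentAut (P : RootPairing ι ℝ M N) (g : N ≃ᵃ[ℝ] N) : Prop :=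
  ∃ (σ : ι ≃ ι) (c : ι → ℤ), ∀ i x, P.root' i (g x) = P.root' (σ i) x + c i

theorem isApartmentAut_affineReflection [P.IsCrystallographic] (a : ι) (n : ℤ) :
    IsApartmentAut P (affineReflection P a n) := by
  refine ⟨P.reflectionPerm a, fun i => n * P.pairingIn ℤ i a, fun i x => ?_⟩
  rw [affineReflection_apply, map_sub, map_smul, root'_reflectionPerm,
    P.root'_coroot_eq_pairing, ← P.algebraMap_pairingIn ℤ]
  simp only [smul_eq_mul, eq_intCast, Int.cast_mul]
  ring

theorem IsApartmentAut.trans {g h : N ≃ᵃ[ℝ] N} (hg : IsApartmentAut P g)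
    (hh : IsApartmentAut P h) : IsApartmentAut P (g.trans h) := by
  obtain ⟨σ, c, hg⟩ := hg
  obtain ⟨τ, d, hh⟩ := hh
  refine ⟨τ.trans σ, fun i => c (τ i) + d i, fun i x => ?_⟩
  rw [AffineEquiv.trans_apply, hh, hg]
  push_cast
  exact add_assoc _ _ _

theorem affineReflection_affineReflection (a : ι) (m n : ℤ) (x : N) :
    affineReflection P a n (affineReflection P a m x) = x + ((n - m : ℤ) : ℝ) • P.coroot a := by
  simp only [affineReflection_apply, map_sub, map_smul, P.root'_coroot_eq_pairing, P.pairing_same,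
    smul_eq_mul]
  push_cast
  module

/-- Translations by integral multiples of coroots permute the affine root hyperplanes. -/
theorem isApartmentAut_constVAdd [P.IsCrystallographic] (a : ι) (n : ℤ) :
    IsApartmentAut P (AffineEquiv.constVAdd ℝ N ((n : ℝ) • P.coroot a)) := by
  -- The translation is the product of the reflections in the parallel walls `H_{α,0}` and
  -- `H_{α,n}`.
  have := (isApartmentAut_affineReflection (P := P) a 0).trans
    (isApartmentAut_affineReflection a n)
  convert this using 1
  ext x
  simp only [AffineEquiv.trans_apply, affineReflection_affineReflection,
    AffineEquiv.constVAdd_apply, vadd_eq_add, sub_zero, add_comm]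

theorem IsApartmentAut.signedPart_iff {g : N ≃ᵃ[ℝ] N} {σ : ι ≃ ι} {c : ι → ℤ}
    (hg : ∀ i x, P.root' i (g x) = P.root' (σ i) x + c i) (e : SignType) (i : ι) (m : ℤ) (x : N) :
    g x ∈ signedPart P e i m ↔ x ∈ signedPart P e (σ i) (m - c i) := by
  cases e
  · change P.root' i (g x) = (m : ℝ) ↔ P.root' (σ i) x = ((m - c i : ℤ) : ℝ)
    rw [hg]; push_cast; exact eq_sub_iff_add_eq.symm
  · change P.root' i (g x) ≤ (m : ℝ) ↔ P.root' (σ i) x ≤ ((m - c i : ℤ) : ℝ)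
    rw [hg]; push_cast; exact le_sub_iff_add_le.symm
  · change (m : ℝ) ≤ P.root' i (g x) ↔ ((m - c i : ℤ) : ℝ) ≤ P.root' (σ i) x
    rw [hg]; push_cast; exact sub_le_iff_le_add.symm

/-- Sign vectors are transported along the permutation of the affine roots. That permutation need
not preserve positivity, hence the description of faces by all roots. -/
theorem IsFace.image [Finite ι] [P.IsCrystallographic] [P.IsReduced] {g : N ≃ᵃ[ℝ] N}
    (hg : IsApartmentAut P g) {F : Set N} (hF : IsFace b F) : IsFace b (g '' F) := by
  rw [isFace_iff] at hF ⊢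
  obtain ⟨hne, ε, rfl⟩ := hF
  obtain ⟨σ, c, hg⟩ := hg
  refine ⟨hne.image _, fun i m => ε (σ i) (m - c i), ?_⟩
  ext y
  obtain ⟨x, rfl⟩ := g.surjective y
  rw [g.injective.mem_set_image]
  simp only [mem_ofPred_eq, IsApartmentAut.signedPart_iff hg]
  constructor
  · intro h i m
    exact h _ _
  · intro h j m
    have := h (σ.symm j) (m + c (σ.symm j))
    rwa [σ.apply_symm_apply, add_sub_cancel_right] at this

theorem HasCodimOne.image (g : N ≃ᵃ[ℝ] N) {F : Set N} (hF : HasCodimOne F) :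
    HasCodimOne (g '' F) := by
  have h : vectorSpan ℝ (g '' F) = (vectorSpan ℝ F).map (g.linear : N →ₗ[ℝ] N) :=
    (AffineMap.map_vectorSpan g.toAffineMap).symm
  unfold HasCodimOne at *
  rw [h, LinearEquiv.finrank_map_eq g.linear, hF]

theorem hyperplaneUnion_eq [Finite ι] [P.IsCrystallographic] [P.IsReduced] :
    hyperplaneUnion b = {x | ∃ (i : ι) (m : ℤ), P.root' i x = m} := by
  ext x
  simp only [hyperplaneUnion, mem_iUnion, exists_prop, hyperplane, mem_ofPred_eq]
  constructor
  · rintro ⟨i, -, m, h⟩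
    exact ⟨i, m, h⟩
  · rintro ⟨i, m, h⟩
    rcases isPos_or_isPos_reflectionPerm b i with hi | hi
    · exact ⟨i, hi, m, h⟩
    · refine ⟨_, hi, -m, ?_⟩
      rw [root'_reflectionPerm_self, h]
      push_cast
      rfl

theorem IsApartmentAut.image_hyperplaneUnion [Finite ι] [P.IsCrystallographic] [P.IsReduced]
    {g : N ≃ᵃ[ℝ] N} (hg : IsApartmentAut P g) :
    g '' (hyperplaneUnion b) = hyperplaneUnion b := by
  obtain ⟨σ, c, hg⟩ := hg
  rw [hyperplaneUnion_eq]
  ext y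
  obtain ⟨x, rfl⟩ := g.surjective y
  rw [g.injective.mem_set_image]
  simp only [mem_ofPred_eq, hg]
  constructor
  · rintro ⟨i, m, h⟩
    refine ⟨σ.symm i, m + c (σ.symm i), ?_⟩
    rw [σ.apply_symm_apply, h]
    push_cast
    rfl
  · rintro ⟨i, m, h⟩
    refine ⟨σ i, m - c i, ?_⟩
    push_cast
    linarith

theorem finiteDimensional_coweightSpace [Finite ι] (P : RootPairing ι ℝ M N) [P.IsRootSystem] :
    FiniteDimensional ℝ N :=
  ⟨⟨(finite_range P.coroot).toFinset, by
    rw [Finite.coe_toFinset]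
    exact RootPairing.IsRootSystem.span_coroot_eq_top⟩⟩

variable [TopologicalSpace N] [IsTopologicalAddGroup N] [ContinuousSMul ℝ N] [T2Space N]

theorem continuous_affineEquiv [FiniteDimensional ℝ N] (g : N ≃ᵃ[ℝ] N) : Continuous g := by
  have h : (g : N → N) = fun x => g.linear x + g 0 := by
    ext x
    have := g.map_vadd 0 x
    simpa only [vadd_eq_add, add_zero] using this
  rw [h]
  exact (LinearMap.continuous_of_finiteDimensional (g.linear : N →ₗ[ℝ] N)).add continuous_const

/-- In finite dimension `g` is a homeomorphism, and it preserves the complement of the walls, so it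
permutes the closures of components. -/
theorem IsAlcove.image [Finite ι] [P.IsRootSystem] [P.IsCrystallographic] [P.IsReduced]
    {g : N ≃ᵃ[ℝ] N} (hg : IsApartmentAut P g) {D : Set N} (hD : IsAlcove b D) :
    IsAlcove b (g '' D) := by
  have := finiteDimensional_coweightSpace P
  obtain ⟨x, hx, rfl⟩ := hD
  let h : N ≃ₜ N := ⟨g.toEquiv, continuous_affineEquiv g, continuous_affineEquiv g.symm⟩
  have hU : h '' (hyperplaneUnion b)ᶜ = (hyperplaneUnion b)ᶜ := by
    rw [image_compl_eq h.bijective]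
    exact congrArg _ hg.image_hyperplaneUnion
  refine ⟨h x, hU ▸ mem_image_of_mem h hx, ?_⟩
  have h1 := h.image_closure (connectedComponentIn (hyperplaneUnion b)ᶜ x)
  rw [h.image_connectedComponentIn hx, hU] at h1
  exact h1

/-- An alcove lies in a strip between two adjacent parallel hyperplanes. -/
theorem IsAlcove.exists_strip [Finite ι] [P.IsRootSystem] {a : ι} (ha : b.IsPos a)
    {D : Set N} (hD : IsAlcove b D) : ∃ m : ℤ, ∀ x ∈ D, (m : ℝ) ≤ P.root' a x ∧
      P.root' a x ≤ m + 1 := by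
  have := finiteDimensional_coweightSpace P
  obtain ⟨x, hx, rfl⟩ := hD
  have hc : Continuous (P.root' a) := LinearMap.continuous_of_finiteDimensional _
  set C := connectedComponentIn (hyperplaneUnion b)ᶜ x
  have hpre : IsPreconnected (P.root' a '' C) :=
    isPreconnected_connectedComponentIn.image _ hc.continuousOn
  -- The image of the open alcove is an interval of `ℝ` without integers, so it cannot leave the
  -- unit interval starting at the floor of one of its values.
  have hoc := hpre.ordConnected
  have hxC : P.root' a x ∈ P.root' a '' C := mem_image_of_mem _ (mem_connectedComponentIn hx)
  have hint : ∀ m : ℤ, (m : ℝ) ∉ P.root' a '' C := by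
    rintro m ⟨y, hy, hm⟩
    refine connectedComponentIn_subset _ _ hy ?_
    exact mem_iUnion.2 ⟨a, mem_iUnion.2 ⟨ha, mem_iUnion.2 ⟨m, hm⟩⟩⟩
  have hcl : IsClosed {y : N | (⌊P.root' a x⌋ : ℝ) ≤ P.root' a y ∧
      P.root' a y ≤ ⌊P.root' a x⌋ + 1} :=
    (isClosed_le continuous_const hc).inter (isClosed_le hc continuous_const)
  refine ⟨⌊P.root' a x⌋, fun y hy => closure_minimal ?_ hcl hy⟩
  intro z hz
  have hzC : P.root' a z ∈ P.root' a '' C := mem_image_of_mem _ hz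
  constructor
  · by_contra! hlt
    exact hint _ (hoc.out hzC hxC ⟨hlt.le, Int.floor_le _⟩)
  · by_contra! hlt
    refine hint (⌊P.root' a x⌋ + 1) (hoc.out hxC hzC ⟨?_, ?_⟩)
    · push_cast; exact (Int.lt_floor_add_one _).le
    · push_cast; exact hlt.le

end ApartmentAutomorphisms

/-! ### The heights of a gallery, and its sections. -/

section Heights

variable {ι M N : Type*} [AddCommGroup M] [Module ℝ M] [AddCommGroup N] [Module ℝ N]
variable {P : RootPairing ι ℝ M N} {a : ι} {δ : GalleryData N}

variable (P a δ) in
/-- The `k`-th small face lies in `H_{α,m}`; we call `m` the height of `k`. -/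
abbrev AtHeight (k : ℕ) (m : ℤ) : Prop := δ.face k ⊆ hyperplane P a m

variable (P a δ) in
/-- The heights of the small faces of `δ` form a path with steps of size at most one. -/
structure IsHeightPath : Prop where
  unique : ∀ {k m m'}, k ≤ δ.len + 1 → AtHeight P a δ k m → AtHeight P a δ k m' → m = m'
  zero : AtHeight P a δ 0 0
  last : AtHeight P a δ (δ.len + 1) ⌊P.root' a δ.wt⌋
  wt_int : (⌊P.root' a δ.wt⌋ : ℝ) = P.root' a δ.wt
  step : ∀ i j x y, i < j → j ≤ δ.len + 1 → AtHeight P a δ i x → AtHeight P a δ j y →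
    (∀ k, i < k → k < j → ∀ m, ¬ AtHeight P a δ k m) → x ≤ y + 1 ∧ y ≤ x + 1

theorem exists_int_root'_of_mem_cocharLattice [P.IsCrystallographic] {x : N}
    (hx : x ∈ cocharLattice P) (a : ι) : ∃ m : ℤ, P.root' a x = m := by
  induction hx using Submodule.span_induction with
  | mem x hx =>
    obtain ⟨i, rfl⟩ := hx
    refine ⟨P.pairingIn ℤ a i, ?_⟩
    rw [P.root'_coroot_eq_pairing, ← P.algebraMap_pairingIn ℤ, eq_intCast]
  | zero => exact ⟨0, by simp⟩
  | add x y _ _ hx hy =>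
    obtain ⟨m, hm⟩ := hx
    obtain ⟨n, hn⟩ := hy
    exact ⟨m + n, by rw [map_add, hm, hn]; push_cast; rfl⟩
  | smul z x _ hx =>
    obtain ⟨m, hm⟩ := hx
    exact ⟨z * m, by rw [map_zsmul, hm, zsmul_eq_mul]; push_cast; rfl⟩

theorem IsGallery.face_nonempty [TopologicalSpace N] {b : P.Base} (h : IsGallery b δ) {k : ℕ}
    (hk : k ≤ δ.len + 1) : (δ.face k).Nonempty := by
  rcases Nat.eq_zero_or_pos k with rfl | h0
  · rw [h.face_zero]; exact singleton_nonempty _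
  · rcases Nat.lt_or_ge δ.len k with h1 | h1
    · obtain rfl : k = δ.len + 1 := by omega
      rw [h.face_last]; exact singleton_nonempty _
    · exact (h.isFace k h0 h1).1.1

/-- If two neighbouring alcoves lie in different strips, their common face is forced into the wall
bounding the first strip and so has a height. Thus between consecutive heights all alcoves share one
strip, and both end faces lie in it. -/
theorem IsGallery.isHeightPath [Finite ι] [P.IsRootSystem] [P.IsCrystallographic]
    [TopologicalSpace N] [IsTopologicalAddGroup N] [ContinuousSMul ℝ N] [T2Space N]
    {b : P.Base} (h : IsGallery b δ) (ha : b.IsPos a) : IsHeightPath P a δ := by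
  have hwt : (⌊P.root' a δ.wt⌋ : ℝ) = P.root' a δ.wt := by
    obtain ⟨m, hm⟩ := exists_int_root'_of_mem_cocharLattice h.wt_mem a
    rw [hm, Int.floor_intCast]
  refine ⟨?_, ?_, ?_, hwt, ?_⟩
  · intro k m m' hk hm hm'
    obtain ⟨x, hx⟩ := h.face_nonempty hk
    have h1 : P.root' a x = m := hm hx
    have h2 : P.root' a x = m' := hm' hx
    exact_mod_cast h1.symm.trans h2
  · rw [AtHeight, h.face_zero, singleton_subset_iff]
    simp [hyperplane]
  · rw [AtHeight, h.face_last, singleton_subset_iff]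
    exact hwt.symm
  · intro i j x y hij hj hx hy hno
    obtain ⟨c, hc⟩ := (h.isAlcove i (by omega)).exists_strip ha
    have key : ∀ k, i ≤ k → k < j → ∀ z ∈ δ.alcove k, (c : ℝ) ≤ P.root' a z ∧
        P.root' a z ≤ c + 1 := by
      intro k hik
      induction k, hik using Nat.le_induction with
      | base => exact fun _ => hc
      | succ k hik ih =>
        intro hkj
        have ih := ih (by omega)
        obtain ⟨c', hc'⟩ := (h.isAlcove (k + 1) (by omega)).exists_strip ha
        have h1 := h.face_succ_subset k (by omega)
        have h2 := h.face_subset (k + 1) (by omega)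
        rcases lt_trichotomy c c' with hlt | rfl | hlt
        · exfalso
          refine hno (k + 1) (by omega) hkj (c + 1) fun z hz => ?_
          have hcc : (c : ℝ) + 1 ≤ c' := by exact_mod_cast hlt
          change P.root' a z = ((c + 1 : ℤ) : ℝ)
          push_cast
          exact le_antisymm (ih z (h1 hz)).2 (hcc.trans (hc' z (h2 hz)).1)
        · exact hc'
        · exfalso
          refine hno (k + 1) (by omega) hkj c fun z hz => ?_
          have hcc : (c' : ℝ) + 1 ≤ c := by exact_mod_cast hlt
          exact le_antisymm ((hc' z (h2 hz)).2.trans hcc) (ih z (h1 hz)).1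
    obtain ⟨p, hp⟩ := h.face_nonempty (k := i) (by omega)
    obtain ⟨q, hq⟩ := h.face_nonempty hj
    have hpx : P.root' a p = x := hx hp
    have hqy : P.root' a q = y := hy hq
    have h1 := hc p (h.face_subset i (by omega) hp)
    have h2 : q ∈ δ.alcove (j - 1) := by
      have := h.face_succ_subset (j - 1) (by omega)
      rw [Nat.sub_add_cancel (by omega)] at this
      exact this hq
    have h2 := key (j - 1) (by omega) (by omega) q h2
    rw [hpx] at h1
    rw [hqy] at h2
    have h3 : c ≤ x := by exact_mod_cast h1.1
    have h4 : x ≤ c + 1 := by exact_mod_cast h1.2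
    have h5 : c ≤ y := by exact_mod_cast h2.1
    have h6 : y ≤ c + 1 := by exact_mod_cast h2.2
    omega

/-- A discrete intermediate value theorem for partially defined integer sequences. -/
theorem exists_between_of_step {A : ℕ → ℤ → Prop} {n : ℕ}
    (step : ∀ i j x y, i < j → j ≤ n → A i x → A j y →
      (∀ k, i < k → k < j → ∀ m, ¬ A k m) → y ≤ x + 1)
    (uniq : ∀ k x y, k ≤ n → A k x → A k y → x = y)
    {i j : ℕ} {x y m : ℤ} (hij : i ≤ j) (hj : j ≤ n) (hi : A i x) (hy : A j y)
    (hxm : x ≤ m) (hmy : m ≤ y) : ∃ k, i ≤ k ∧ k ≤ j ∧ A k m := by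
  classical
  -- The starting index jumps to the next index that has a value; that value exceeds `x` by at most
  -- one, so it has not passed `m`.
  induction hd : j - i using Nat.strong_induction_on generalizing i x with
  | _ d ih =>
    rcases hxm.eq_or_lt with rfl | hlt
    · exact ⟨i, le_rfl, hij, hi⟩
    rcases hij.eq_or_lt with rfl | hlt'
    · exact absurd (uniq _ _ _ hj hi hy) (by omega)
    have hex : ∃ k, i < k ∧ k ≤ j ∧ ∃ z, A k z := ⟨j, hlt', le_rfl, y, hy⟩
    obtain ⟨h1, h2, z, hz⟩ := Nat.find_spec hex
    have hstep := step i (Nat.find hex) x z h1 (h2.trans hj) hi hz fun k hk hk' w hw =>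
      Nat.find_min hex hk' ⟨hk, by omega, w, hw⟩
    obtain ⟨k, hk, hk', hA⟩ := ih (j - Nat.find hex) (by omega) h2 hz (by omega) rfl
    exact ⟨k, by omega, hk', hA⟩

/-! ### Minimal height and intervals witnessing stability. -/

namespace IsHeightPath

theorem exists_between_up (hp : IsHeightPath P a δ) {i j : ℕ} {x y m : ℤ} (hij : i ≤ j)
    (hj : j ≤ δ.len + 1) (hi : AtHeight P a δ i x) (hy : AtHeight P a δ j y)
    (hxm : x ≤ m) (hmy : m ≤ y) : ∃ k, i ≤ k ∧ k ≤ j ∧ AtHeight P a δ k m :=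
  exists_between_of_step (fun i j x y h1 h2 h3 h4 h5 => (hp.step i j x y h1 h2 h3 h4 h5).2)
    (fun _ _ _ h1 h2 h3 => hp.unique h1 h2 h3) hij hj hi hy hxm hmy

theorem exists_between_down (hp : IsHeightPath P a δ) {i j : ℕ} {x y m : ℤ} (hij : i ≤ j)
    (hj : j ≤ δ.len + 1) (hi : AtHeight P a δ i x) (hy : AtHeight P a δ j y)
    (hxm : m ≤ x) (hmy : y ≤ m) : ∃ k, i ≤ k ∧ k ≤ j ∧ AtHeight P a δ k m := by
  -- Reversing the sign of all heights turns descents into ascents.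
  have := exists_between_of_step (A := fun k m => AtHeight P a δ k (-m)) (n := δ.len + 1)
    (fun i j x y h1 h2 h3 h4 h5 => by
      have := (hp.step i j (-x) (-y) h1 h2 h3 h4 fun k hk hk' m hm =>
        h5 k hk hk' (-m) (by simpa using hm)).1
      omega)
    (fun _ _ _ h1 h2 h3 => neg_injective (hp.unique h1 h2 h3)) (x := -x) (y := -y) (m := -m)
    hij hj (by simpa using hi) (by simpa using hy) (by omega) (by omega)
  simpa using this

/-- Provides the lower bound without which the integer infimum in `minHeight` need not be attained.
-/
theorem finite_heights (hp : IsHeightPath P a δ) :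
    {m | ∃ k ≤ δ.len + 1, AtHeight P a δ k m}.Finite := by
  refine ((finite_Iic (δ.len + 1)).biUnion (t := fun k => {m | k ≤ δ.len + 1 ∧
    AtHeight P a δ k m}) fun k _ => Subsingleton.finite fun x hx y hy =>
      hp.unique hx.1 hx.2 hy.2).subset ?_
  rintro m ⟨k, hk, hm⟩
  exact mem_biUnion (show k ∈ Iic (δ.len + 1) from hk) ⟨hk, hm⟩

theorem isLeast_minHeight (hp : IsHeightPath P a δ) :
    IsLeast {m | ∃ k ≤ δ.len + 1, AtHeight P a δ k m} (minHeight P a δ) :=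
  ⟨Int.csInf_mem ⟨0, 0, Nat.zero_le _, hp.zero⟩ hp.finite_heights.bddBelow,
    fun _ hm => csInf_le hp.finite_heights.bddBelow hm⟩

theorem minHeight_le (hp : IsHeightPath P a δ) {k : ℕ} {m : ℤ} (hk : k ≤ δ.len + 1)
    (h : AtHeight P a δ k m) : minHeight P a δ ≤ m := hp.isLeast_minHeight.2 ⟨k, hk, h⟩

/-- Excluding the single height `m - 1` excludes everything below it, as a path starting at height
`m` cannot jump over `m - 1`. -/
theorem le_of_stableWitness (hp : IsHeightPath P a δ) {k l r s : ℕ} {m x : ℤ}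
    (w : StableWitness P a δ k m l r) (hls : l ≤ s) (hsr : s ≤ r) (hs : AtHeight P a δ s x) :
    m ≤ x := by
  obtain ⟨hlk, hkr, hr, hrm, hlm, hno⟩ := w
  by_contra! hlt
  obtain ⟨k', h1, h2, h3⟩ := hp.exists_between_down (m := m - 1) hls (hsr.trans hr) hlm hs
    (by omega) (by omega)
  rcases (h2.trans hsr).eq_or_lt with rfl | h4
  · have := hp.unique hr h3 hrm
    omega
  · exact hno k' h1 h4 h3

theorem exists_isStableAt (hp : IsHeightPath P a δ) {k : ℕ} (hk : IsStable P a δ k) :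
    ∃ m, IsStableAt P a δ k m := by
  have hb : BddBelow {m | ∃ l r, StableWitness P a δ k m l r} :=
    by
    refine hp.finite_heights.bddBelow.mono ?_
    rintro m ⟨l, r, h⟩
    exact ⟨r, h.2.2.1, h.2.2.2.1⟩
  exact ⟨_, Int.csInf_mem hk hb, fun _ hm => csInf_le hb hm⟩

/-- The extremal `l` and `r` may come from different witnesses. They still combine, because
shrinking an interval around `k` keeps the condition on `m - 1`. -/
theorem exists_stable_interval {k : ℕ} {m : ℤ} (h : ∃ l r, StableWitness P a δ k m l r) :
    ∃ l r, StableWitness P a δ k m l r ∧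
      IsLeast {r | ∃ l, StableWitness P a δ k m l r} r ∧
      IsGreatest {l | ∃ r, StableWitness P a δ k m l r} l := by
  obtain ⟨l₀, r₀, h⟩ := h
  have h1 : IsLeast {r | ∃ l, StableWitness P a δ k m l r} _ :=
    ⟨Nat.sInf_mem ⟨r₀, l₀, h⟩, fun _ hr => Nat.sInf_le hr⟩
  have hb : BddAbove {l | ∃ r, StableWitness P a δ k m l r} := ⟨k, fun l ⟨r, h⟩ => h.1⟩
  have h2 : IsGreatest {l | ∃ r, StableWitness P a δ k m l r} _ :=
    ⟨Nat.sSup_mem ⟨l₀, r₀, h⟩ hb, fun _ hl => le_csSup hb hl⟩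
  refine ⟨_, _, ?_, h1, h2⟩
  obtain ⟨l, hl⟩ := h1.1
  obtain ⟨r, hr⟩ := h2.1
  have hll := h2.2 ⟨_, hl⟩
  exact ⟨hr.1, hl.2.1, hl.2.2.1, hl.2.2.2.1, hr.2.2.2.2.1,
    fun s hs hs' => hl.2.2.2.2.2 s (hll.trans hs) hs'⟩

/-- The minimal interval of `k` is that of each of its alcoves. A witness for `k'` at a lower level
must stick out of `[i, j]` on both sides, hence also serves `k`. An index of height `m` strictly
inside `[i, j]` would be a better right or left end for `k`, according to its side. -/
theorem stable_interval_spec (hp : IsHeightPath P a δ) {k i j : ℕ} {m : ℤ}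
    (hm : IsStableAt P a δ k m) (w : StableWitness P a δ k m i j)
    (hj : IsLeast {r | ∃ l, StableWitness P a δ k m l r} j)
    (hi : IsGreatest {l | ∃ r, StableWitness P a δ k m l r} i) {k' : ℕ} (hik : i ≤ k')
    (hkj : k' < j) :
    IsStableAt P a δ k' m ∧ IsLeast {r | ∃ l, StableWitness P a δ k' m l r} j ∧
      IsGreatest {l | ∃ r, StableWitness P a δ k' m l r} i := by
  have w' : StableWitness P a δ k' m i j := ⟨hik, hkj, w.2.2⟩
  obtain ⟨w1, w2, w3, w4, w5, w6⟩ := w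
  refine ⟨⟨⟨i, j, w'⟩, ?_⟩, ⟨⟨i, w'⟩, ?_⟩, ⟨⟨j, w'⟩, ?_⟩⟩
  · rintro m' ⟨l, r, v⟩
    obtain ⟨v1, v2, v3, v4, v5, v6⟩ := id v
    by_contra! hlt
    have h1 : l < i := by
      by_contra! hle
      have := hp.le_of_stableWitness w' hle (by omega) v5
      omega
    have h2 : j < r := by
      by_contra! hle
      have := hp.le_of_stableWitness w' (by omega) hle v4
      omega
    have := hm.2 ⟨l, r, by omega, by omega, v3, v4, v5, v6⟩
    omega
  · rintro r ⟨l, v1, v2, v3, v4, v5, v6⟩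
    by_contra! hlt
    rcases Nat.lt_or_ge k r with h | h
    · have := hj.2 ⟨i, w1, h, v3, v4, w5, fun s hs hs' => w6 s hs (by omega)⟩
      omega
    · have := hi.2 ⟨j, h, w2, w3, w4, v4, fun s hs hs' => w6 s (by omega) hs'⟩
      omega
  · rintro l ⟨r, v1, v2, v3, v4, v5, v6⟩
    by_contra! hlt
    rcases Nat.lt_or_ge k l with h | h
    · have := hj.2 ⟨i, w1, h, by omega, v5, w5, fun s hs hs' => w6 s hs (by omega)⟩
      omega
    · have := hi.2 ⟨j, h, w2, w3, w4, v5, fun s hs hs' => w6 s (by omega) hs'⟩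
      omega

theorem isStableSection_iff (hp : IsHeightPath P a δ) {i j : ℕ} :
    IsStableSection P a δ i j ↔ i < j ∧ j ≤ δ.len + 1 ∧ ∃ m, ∀ k, i ≤ k → k < j →
      IsStableAt P a δ k m ∧ IsLeast {r | ∃ l, StableWitness P a δ k m l r} j ∧
        IsGreatest {l | ∃ r, StableWitness P a δ k m l r} i := by
  constructor
  · rintro ⟨k, m, hik, hkj, hm, hj, hi⟩
    obtain ⟨l, r, w, hr, hl⟩ := exists_stable_interval hm.1
    obtain rfl := hr.unique hj
    obtain rfl := hl.unique hi
    exact ⟨by omega, w.2.2.1, m, fun k' h1 h2 => hp.stable_interval_spec hm w hr hl h1 h2⟩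
  · rintro ⟨hij, -, m, h⟩
    exact ⟨i, m, le_rfl, hij, h i le_rfl hij⟩

end IsHeightPath

variable (P a δ) in
/-- `i < j` are consecutive among the indices that have a height, the heights being `x` and `y`. -/
def IsStep (i j : ℕ) (x y : ℤ) : Prop :=
  i < j ∧ j ≤ δ.len + 1 ∧ AtHeight P a δ i x ∧ AtHeight P a δ j y ∧
    ∀ k, i < k → k < j → ∀ z, ¬ AtHeight P a δ k z

theorem IsStep.le_or_le {i j k : ℕ} {x y z : ℤ} (h : IsStep P a δ i j x y)
    (hk : AtHeight P a δ k z) : k ≤ i ∨ j ≤ k := by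
  by_contra! hlt
  exact h.2.2.2.2 k hlt.1 hlt.2 z hk

theorem IsStep.of_stableWitness {i j k l r : ℕ} {x y m : ℤ} (h : IsStep P a δ i j x y)
    (hik : i ≤ k) (hkj : k < j) (w : StableWitness P a δ k m l r) : l ≤ i ∧ j ≤ r := by
  have h1 := h.le_or_le w.2.2.2.1
  have h2 := h.le_or_le w.2.2.2.2.1
  have := w.1
  have := w.2.1
  omega

/-- The ends of a witnessing interval have heights, so they cannot fall strictly inside a step; the
interval contains the step as a whole. -/
theorem IsStep.isStable {i j k : ℕ} {x y : ℤ} (h : IsStep P a δ i j x y)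
    (hik : i ≤ k) (hkj : k < j) (hk : IsStable P a δ k) : IsStable P a δ i := by
  obtain ⟨m, l, r, w⟩ := hk
  obtain ⟨h1, h2⟩ := h.of_stableWitness hik hkj w
  have := h.1
  exact ⟨m, l, r, h1, by omega, w.2.2⟩

theorem IsStep.eq_of_overlap {i j i' j' k : ℕ} {x y x' y' : ℤ} (h : IsStep P a δ i j x y)
    (h' : IsStep P a δ i' j' x' y') (h1 : i ≤ k) (h2 : k < j) (h3 : i' ≤ k) (h4 : k < j') :
    i = i' ∧ j = j' := by
  have e1 := h.le_or_le h'.2.2.1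
  have e2 := h.le_or_le h'.2.2.2.1
  have e3 := h'.le_or_le h.2.2.1
  have e4 := h'.le_or_le h.2.2.2.1
  omega

/-- The definition forbids only the heights `m` and `m + d` inside `[i, j]`. Any other height there
would make the path meet `m` again before `j`, or `m + d` too early. -/
theorem IsHeightPath.isDirectedSection_iff (hp : IsHeightPath P a δ) {i j : ℕ} {d : ℤ}
    (hd : d = 1 ∨ d = -1) : IsDirectedSection P a δ d i j ↔
      (∃ m, IsStep P a δ i j m (m + d)) ∧ ¬ IsStable P a δ i := by
  constructor
  · rintro ⟨hij, hj, ⟨m, hm⟩, hst⟩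
    have hi' : AtHeight P a δ i m := (hm i le_rfl hij.le).1.2 rfl
    have hj' : AtHeight P a δ j (m + d) := (hm j hij.le le_rfl).2.2 rfl
    refine ⟨⟨m, hij, hj, hi', hj', fun k hik hkj z hz => ?_⟩, hst i le_rfl hij⟩
    have hzm : z ≠ m := by
      rintro rfl
      have := (hm k hik.le hkj.le).1.1 hz
      omega
    have hzd : z ≠ m + d := by
      rintro rfl
      have := (hm k hik.le hkj.le).2.1 hz
      omega
    have aux1 : ∀ k', k ≤ k' → k' ≤ j → ¬ AtHeight P a δ k' m := fun k' h1 h2 h3 => by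
      have := (hm k' (by omega) h2).1.1 h3
      omega
    have aux2 : ∀ k', i ≤ k' → k' ≤ k → ¬ AtHeight P a δ k' (m + d) := fun k' h1 h2 h3 => by
      have := (hm k' h1 (by omega)).2.1 h3
      omega
    rcases hd with rfl | rfl
    · rcases lt_or_gt_of_ne hzm with h | h
      · obtain ⟨k', h1, h2, h3⟩ := hp.exists_between_up (m := m) hkj.le hj hz hj'
          (by omega) (by omega)
        exact aux1 k' h1 h2 h3
      · obtain ⟨k', h1, h2, h3⟩ := hp.exists_between_up (m := m + 1) hik.le (by omega) hi' hz
          (by omega) (by omega)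
        exact aux2 k' h1 h2 h3
    · rcases lt_or_gt_of_ne hzm with h | h
      · obtain ⟨k', h1, h2, h3⟩ := hp.exists_between_down (m := m + -1) hik.le (by omega) hi' hz
          (by omega) (by omega)
        exact aux2 k' h1 h2 h3
      · obtain ⟨k', h1, h2, h3⟩ := hp.exists_between_down (m := m) hkj.le hj hz hj'
          (by omega) (by omega)
        exact aux1 k' h1 h2 h3
  · rintro ⟨⟨m, h⟩, hst⟩
    refine ⟨h.1, h.2.1, ⟨m, fun k hik hkj => ⟨⟨fun hk => ?_, ?_⟩, ⟨fun hk => ?_, ?_⟩⟩⟩,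
      fun k hik hkj hk => hst (h.isStable hik hkj hk)⟩
    · rcases h.le_or_le hk with h1 | h1
      · omega
      · obtain rfl : k = j := by omega
        have := hp.unique h.2.1 h.2.2.2.1 hk
        omega
    · rintro rfl; exact h.2.2.1
    · rcases h.le_or_le hk with h1 | h1
      · obtain rfl : k = i := by omega
        have := hp.unique (hkj.trans h.2.1) h.2.2.1 hk
        omega
      · omega
    · rintro rfl; exact h.2.2.2.1

namespace IsHeightPath

theorem exists_isStep (hp : IsHeightPath P a δ) {k : ℕ} (hk : k ≤ δ.len) :
    ∃ i j x y, i ≤ k ∧ k < j ∧ IsStep P a δ i j x y := by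
  classical
  have hex : ∃ j, k < j ∧ j ≤ δ.len + 1 ∧ ∃ y, AtHeight P a δ j y :=
    ⟨δ.len + 1, by omega, le_rfl, _, hp.last⟩
  obtain ⟨h1, h2, y, hy⟩ := Nat.find_spec hex
  have hb : BddAbove {i | i ≤ k ∧ ∃ x, AtHeight P a δ i x} := ⟨k, fun i hi => hi.1⟩
  obtain ⟨h3, x, hx⟩ := Nat.sSup_mem (s := {i | i ≤ k ∧ ∃ x, AtHeight P a δ i x})
    ⟨0, Nat.zero_le _, 0, hp.zero⟩ hb
  refine ⟨_, _, x, y, h3, h1, lt_of_le_of_lt h3 h1, h2, hx, hy, fun s hs hs' z hz => ?_⟩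
  rcases Nat.lt_or_ge k s with h | h
  · exact Nat.find_min hex hs' ⟨h, by omega, z, hz⟩
  · exact absurd (le_csSup hb (show s ∈ {i | i ≤ k ∧ ∃ x, AtHeight P a δ i x} from ⟨h, z, hz⟩))
      (by omega)

/-- For an unstable alcove the surrounding step has different end heights, since a step between
equal heights is itself a witness of stability. The difference is then `±1`. -/
theorem exists_isSection (hp : IsHeightPath P a δ) {k : ℕ} (hk : k ≤ δ.len) :
    ∃ i j, i ≤ k ∧ k < j ∧ ∃ T, IsSection P a δ T i j := by
  by_cases hst : IsStable P a δ k
  · obtain ⟨m, hm⟩ := hp.exists_isStableAt hst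
    obtain ⟨l, r, w, hr, hl⟩ := exists_stable_interval hm.1
    exact ⟨l, r, w.1, w.2.1, .stable, k, m, w.1, w.2.1, hm, hr, hl⟩
  · obtain ⟨i, j, x, y, hik, hkj, h⟩ := hp.exists_isStep hk
    have hsi : ¬ IsStable P a δ i := by
      rintro ⟨m, l, r, w⟩
      obtain ⟨h1, h2⟩ := h.of_stableWitness le_rfl h.1 w
      exact hst ⟨m, l, r, by omega, by omega, w.2.2⟩
    have hxy := hp.step i j x y h.1 h.2.1 h.2.2.1 h.2.2.2.1 h.2.2.2.2
    have hne : x ≠ y := by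
      rintro rfl
      refine hst ⟨x, i, j, hik, hkj, h.2.1, h.2.2.2.1, h.2.2.1, fun s hs hs' hA => ?_⟩
      have := h.le_or_le hA
      obtain rfl : s = i := by omega
      have := hp.unique (by have := h.2.1; omega) h.2.2.1 hA
      omega
    rcases lt_or_gt_of_ne hne with hlt | hlt
    · obtain rfl : y = x + 1 := by omega
      exact ⟨i, j, hik, hkj, .directed, (hp.isDirectedSection_iff (Or.inl rfl)).2 ⟨⟨x, h⟩, hsi⟩⟩
    · obtain rfl : y = x + -1 := by omega
      exact ⟨i, j, hik, hkj, .antidirected,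
        (hp.isDirectedSection_iff (Or.inr rfl)).2 ⟨⟨x, h⟩, hsi⟩⟩

theorem isSection_lt (hp : IsHeightPath P a δ) {T : SectionKind} {i j : ℕ}
    (h : IsSection P a δ T i j) : i < j ∧ j ≤ δ.len + 1 := by
  cases T
  · exact ⟨h.1, h.2.1⟩
  · exact ⟨h.1, h.2.1⟩
  · have := hp.isStableSection_iff.1 h
    exact ⟨this.1, this.2.1⟩

/-- The common alcove `k` determines everything: its stability separates stable from directed
sections, its step determines a directed section with its sign, and its least level determines a
stable one. Uniqueness of partitions and of kinds both rest on this. -/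
theorem isSection_eq_of_overlap (hp : IsHeightPath P a δ) {T T' : SectionKind}
    {i j i' j' k : ℕ} (h : IsSection P a δ T i j) (h' : IsSection P a δ T' i' j')
    (h1 : i ≤ k) (h2 : k < j) (h3 : i' ≤ k) (h4 : k < j') : i = i' ∧ j = j' ∧ T = T' := by
  have aux : ∀ d d' : ℤ, (d = 1 ∨ d = -1) → (d' = 1 ∨ d' = -1) →
      IsDirectedSection P a δ d i j → IsDirectedSection P a δ d' i' j' →
      i = i' ∧ j = j' ∧ d = d' := by
    intro d d' hd hd' hs hs'
    obtain ⟨⟨m, hm⟩, -⟩ := (hp.isDirectedSection_iff hd).1 hs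
    obtain ⟨⟨m', hm'⟩, -⟩ := (hp.isDirectedSection_iff hd').1 hs'
    obtain ⟨rfl, rfl⟩ := hm.eq_of_overlap hm' h1 h2 h3 h4
    have e1 := hp.unique (by have := hm.2.1; omega) hm.2.2.1 hm'.2.2.1
    have e2 := hp.unique hm.2.1 hm.2.2.2.1 hm'.2.2.2.1
    exact ⟨rfl, rfl, by omega⟩
  have aux2 : ∀ {i j}, IsStableSection P a δ i j → i ≤ k → k < j → IsStable P a δ k := by
    intro i j h h1 h2
    obtain ⟨-, -, m, h⟩ := hp.isStableSection_iff.1 h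
    exact ⟨m, (h k h1 h2).1.1⟩
  have c1 : (1 : ℤ) = 1 ∨ (1 : ℤ) = -1 := Or.inl rfl
  have c2 : (-1 : ℤ) = 1 ∨ (-1 : ℤ) = -1 := Or.inr rfl
  cases T <;> cases T'
  · obtain ⟨e1, e2, -⟩ := aux 1 1 c1 c1 h h'
    exact ⟨e1, e2, rfl⟩
  · obtain ⟨-, -, e3⟩ := aux 1 (-1) c1 c2 h h'
    exact absurd e3 (by decide)
  · exact absurd (aux2 h' h3 h4) (h.2.2.2 k h1 h2)
  · obtain ⟨-, -, e3⟩ := aux (-1) 1 c2 c1 h h'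
    exact absurd e3 (by decide)
  · obtain ⟨e1, e2, -⟩ := aux (-1) (-1) c2 c2 h h'
    exact ⟨e1, e2, rfl⟩
  · exact absurd (aux2 h' h3 h4) (h.2.2.2 k h1 h2)
  · exact absurd (aux2 h h1 h2) (h'.2.2.2 k h3 h4)
  · exact absurd (aux2 h h1 h2) (h'.2.2.2 k h3 h4)
  · obtain ⟨-, -, m, h⟩ := hp.isStableSection_iff.1 h
    obtain ⟨-, -, m', h'⟩ := hp.isStableSection_iff.1 h'
    obtain ⟨a1, a2, a3⟩ := h k h1 h2
    obtain ⟨b1, b2, b3⟩ := h' k h3 h4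
    obtain rfl : m = m' := IsLeast.unique a1 b1
    exact ⟨a3.unique b3, a2.unique b2, rfl⟩

/-- A section lies in every partition as a pair of consecutive elements. -/
theorem isConsecutive_iff (hp : IsHeightPath P a δ) {S : Finset ℕ}
    (hS : IsSectionPartition P a δ S) {i j : ℕ} :
    IsConsecutive S i j ↔ ∃ T, IsSection P a δ T i j := by
  refine ⟨hS.2.2.2 i j, ?_⟩
  rintro ⟨T, hT⟩
  obtain ⟨hij, hj⟩ := hp.isSection_lt hT
  obtain ⟨h0, hn, hle, hsec⟩ := hS
  -- The last element of `S` up to `i` and the first one after `i` bound a section of the partition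
  -- that shares the alcove `i` with `[i, j]`.
  have hne1 : (S.filter (· ≤ i)).Nonempty := ⟨0, by simp [h0]⟩
  have hne2 : (S.filter (i < ·)).Nonempty := ⟨δ.len + 1, by simp [hn]; omega⟩
  obtain ⟨m1, m2⟩ := Finset.mem_filter.1 (Finset.max'_mem (S.filter (· ≤ i)) hne1)
  obtain ⟨m3, m4⟩ := Finset.mem_filter.1 (Finset.min'_mem (S.filter (i < ·)) hne2)
  set p := (S.filter (· ≤ i)).max' hne1
  set q := (S.filter (i < ·)).min' hne2
  have hc : IsConsecutive S p q := by
    refine ⟨m1, m3, by omega, fun k hk hlt => ?_⟩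
    rcases Nat.lt_or_ge i k with h | h
    · exact absurd (Finset.min'_le (S.filter (i < ·)) k (Finset.mem_filter.2 ⟨hk, h⟩)) (by omega)
    · exact absurd (Finset.le_max' (S.filter (· ≤ i)) k (Finset.mem_filter.2 ⟨hk, h⟩)) (by omega)
  obtain ⟨T', hT'⟩ := hsec p q hc
  obtain ⟨e1, e2, -⟩ := hp.isSection_eq_of_overlap hT hT' le_rfl hij m2 m4
  rwa [e1, e2]

theorem existsUnique_partition (hp : IsHeightPath P a δ) :
    ∃! S, IsSectionPartition P a δ S := by
  classical
  have huniq : ∀ S S', IsSectionPartition P a δ S → IsSectionPartition P a δ S' → S ⊆ S' := by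
    intro S S' hS hS' x hx
    rcases (hS.2.2.1 x hx).eq_or_lt with rfl | hlt
    · exact hS'.2.1
    have hne : (S.filter (x < ·)).Nonempty := ⟨δ.len + 1, by simp [hS.2.1, hlt]⟩
    obtain ⟨m3, m4⟩ := Finset.mem_filter.1 (Finset.min'_mem (S.filter (x < ·)) hne)
    have hc : IsConsecutive S x ((S.filter (x < ·)).min' hne) :=
      ⟨hx, m3, m4, fun k hk h =>
        absurd (Finset.min'_le (S.filter (x < ·)) k (Finset.mem_filter.2 ⟨hk, h.1⟩))
        (by omega)⟩
    exact ((hp.isConsecutive_iff hS').2 ((hp.isConsecutive_iff hS).1 hc)).1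
  -- The partition consists of the left ends of all sections together with the final index.
  let S := (Finset.range (δ.len + 2)).filter
    fun i => i = δ.len + 1 ∨ ∃ j T, IsSection P a δ T i j
  have hmem : ∀ i, i ∈ S ↔ i = δ.len + 1 ∨ ∃ j T, IsSection P a δ T i j := by
    intro i
    simp only [S, Finset.mem_filter, Finset.mem_range, and_iff_right_iff_imp]
    rintro (rfl | ⟨j, T, h⟩)
    · omega
    · have := hp.isSection_lt h
      omega
  have hS : IsSectionPartition P a δ S := by
    refine ⟨?_, (hmem _).2 (Or.inl rfl), fun k hk => ?_, ?_⟩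
    · obtain ⟨i, j, hi, -, h⟩ := hp.exists_isSection (Nat.zero_le δ.len)
      obtain rfl : i = 0 := by omega
      exact (hmem _).2 (Or.inr ⟨j, h⟩)
    · rcases (hmem k).1 hk with rfl | ⟨j, T, h⟩
      · exact le_rfl
      · have := hp.isSection_lt h
        omega
    · rintro i j ⟨hi, hj, hij, hno⟩
      have hj' : j ≤ δ.len + 1 := by
        rcases (hmem j).1 hj with rfl | ⟨j', T, h⟩
        · exact le_rfl
        · have := hp.isSection_lt h
          omega
      rcases (hmem i).1 hi with rfl | ⟨j', T, h⟩
      · omega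
      have hlt := hp.isSection_lt h
      have hj'S : j' ∈ S := by
        rcases hlt.2.eq_or_lt with rfl | hlt'
        · exact (hmem _).2 (Or.inl rfl)
        -- The section through the alcove `j'` must begin at `j'`: otherwise it shares the alcove
        -- `j' - 1` with `[i, j']` and would end at `j'`.
        obtain ⟨p, q, hp1, hp2, T', h'⟩ := hp.exists_isSection (k := j') (by omega)
        rcases hp1.eq_or_lt with rfl | hlt''
        · exact (hmem _).2 (Or.inr ⟨q, T', h'⟩)
        obtain ⟨-, rfl, -⟩ := hp.isSection_eq_of_overlap (k := j' - 1) h h' (by omega) (by omega)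
          (by omega) (by omega)
        omega
      have h1 := hno j' hj'S
      have h2 : ¬ (j < j') := by
        intro h2
        rcases (hmem j).1 hj with rfl | ⟨j₂, T₂, h₂⟩
        · omega
        obtain ⟨rfl, -⟩ := hp.isSection_eq_of_overlap (k := j) h h₂ hij.le h2 le_rfl
          (hp.isSection_lt h₂).1
        omega
      obtain rfl : j = j' := by omega
      exact ⟨T, h⟩
  exact ⟨S, hS, fun S' hS' => (huniq _ _ hS' hS).antisymm (huniq _ _ hS hS')⟩

end IsHeightPath

end Heights

/-! ### Reversing one step of a gallery: effect on heights and sections. -/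

section Folding

variable {ι M N : Type*} [AddCommGroup M] [Module ℝ M] [AddCommGroup N] [Module ℝ N]
variable {P : RootPairing ι ℝ M N} {a : ι} {δ δ' : GalleryData N}

variable (P a δ δ') in
/-- `δ` and `δ'` have the same heights before `t`, and heights differing by `c` from `t` on, while
the alcoves between the consecutive heights `s` and `t` are not stable. -/
structure IsHeightShift (s t : ℕ) (c : ℤ) : Prop where
  len_eq : δ'.len = δ.len
  step : ∃ x y, IsStep P a δ s t x y
  step' : ∃ x y, IsStep P a δ' s t x y
  below : ∀ k < t, ∀ m, AtHeight P a δ' k m ↔ AtHeight P a δ k m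
  above : ∀ k, t ≤ k → k ≤ δ.len + 1 → ∀ m, AtHeight P a δ' k (m + c) ↔ AtHeight P a δ k m
  not_stable : ¬ IsStable P a δ s
  not_stable' : ¬ IsStable P a δ' s

namespace IsHeightShift

variable {s t : ℕ} {c : ℤ}

theorem symm (h : IsHeightShift P a δ δ' s t c) : IsHeightShift P a δ' δ s t (-c) where
  len_eq := h.len_eq.symm
  step := h.step'
  step' := h.step
  below k hk m := (h.below k hk m).symm
  above k hk hk' m := by
    rw [h.len_eq] at hk'
    rw [← h.above k hk hk', neg_add_cancel_right]
  not_stable := h.not_stable'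
  not_stable' := h.not_stable

/-- A witnessing interval cannot contain the unstable step `[s, t]`, nor end strictly inside it. So
it lies up to `s`, where heights agree, or from `t` on, where all are shifted by `c`. -/
theorem stableWitness (h : IsHeightShift P a δ δ' s t c) {k l r : ℕ} {m : ℤ}
    (w : StableWitness P a δ k m l r) :
    StableWitness P a δ' k (m + if k < t then 0 else c) l r := by
  obtain ⟨x, y, hs⟩ := h.step
  obtain ⟨w1, w2, w3, w4, w5, w6⟩ := w
  have e1 := hs.le_or_le w4
  have e2 := hs.le_or_le w5
  have e3 : ¬ (l ≤ s ∧ s < r) := fun e => h.not_stable ⟨m, l, r, e.1, e.2, w3, w4, w5, w6⟩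
  have hst := hs.1
  have hlen := h.len_eq
  by_cases hkt : k < t
  · rw [if_pos hkt, add_zero]
    refine ⟨w1, w2, by omega, (h.below r (by omega) m).2 w4, (h.below l (by omega) m).2 w5,
      fun u hu hu' hA => w6 u hu hu' ((h.below u (by omega) _).1 hA)⟩
  · rw [if_neg hkt]
    refine ⟨w1, w2, by omega, (h.above r (by omega) w3 m).2 w4,
      (h.above l (by omega) (by omega) m).2 w5,
      fun u hu hu' hA => w6 u hu hu' ((h.above u (by omega) (by omega) _).1 ?_)⟩
    convert hA using 2
    ring

theorem stableWitness_iff (h : IsHeightShift P a δ δ' s t c) {k l r : ℕ} {m : ℤ} :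
    StableWitness P a δ' k (m + if k < t then 0 else c) l r ↔ StableWitness P a δ k m l r := by
  refine ⟨fun w => ?_, h.stableWitness⟩
  have := h.symm.stableWitness w
  convert this using 1
  split_ifs <;> ring

theorem isStable (h : IsHeightShift P a δ δ' s t c) {k : ℕ} (hk : IsStable P a δ k) :
    IsStable P a δ' k := by
  obtain ⟨m, l, r, w⟩ := hk
  exact ⟨_, l, r, h.stableWitness w⟩

theorem isStableSection (h : IsHeightShift P a δ δ' s t c) {i j : ℕ}
    (hij : IsStableSection P a δ i j) : IsStableSection P a δ' i j := by
  obtain ⟨k, m, hik, hkj, ⟨⟨l, r, w⟩, hm⟩, hj, hi⟩ := hij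
  refine ⟨k, m + if k < t then 0 else c, hik, hkj, ⟨⟨l, r, h.stableWitness w⟩, ?_⟩, ?_, ?_⟩
  · rintro m' ⟨l', r', w'⟩
    have := hm ⟨l', r', h.symm.stableWitness w'⟩
    split_ifs at this ⊢ <;> omega
  · simpa only [h.stableWitness_iff] using hj
  · simpa only [h.stableWitness_iff] using hi

theorem isStep (h : IsHeightShift P a δ δ' s t c) {i j : ℕ} {x y : ℤ}
    (hij : IsStep P a δ i j x y) (hne : (i, j) ≠ (s, t)) :
    ∃ z, IsStep P a δ' i j (x + z) (y + z) := by
  obtain ⟨u, v, hs⟩ := h.step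
  have hlen := h.len_eq
  have e1 := hs.le_or_le hij.2.2.1
  have e2 := hs.le_or_le hij.2.2.2.1
  have e3 := hij.le_or_le hs.2.2.1
  have e4 := hij.le_or_le hs.2.2.2.1
  have hne' : ¬ (i = s ∧ j = t) := fun e => hne (by rw [e.1, e.2])
  obtain ⟨f1, f2, f3, f4, f5⟩ := hij
  have hst := hs.1
  rcases Nat.lt_or_ge i t with hit | hit
  · refine ⟨0, f1, by omega, ?_, ?_, fun k hk hk' z hz => ?_⟩
    · rw [add_zero]; exact (h.below i hit _).2 f3
    · rw [add_zero]; exact (h.below j (by omega) _).2 f4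
    · exact f5 k hk hk' z ((h.below k (by omega) _).1 hz)
  · refine ⟨c, f1, by omega, ?_, ?_, fun k hk hk' z hz => ?_⟩
    · exact (h.above i hit (by omega) _).2 f3
    · exact (h.above j (by omega) f2 _).2 f4
    · refine f5 k hk hk' (z - c) ((h.above k (by omega) (by omega) _).1 ?_)
      rwa [sub_add_cancel]

theorem isDirectedSection (h : IsHeightShift P a δ δ' s t c) (hp : IsHeightPath P a δ)
    (hp' : IsHeightPath P a δ') {i j : ℕ} {d : ℤ} (hd : d = 1 ∨ d = -1)
    (hij : IsDirectedSection P a δ d i j) (hne : (i, j) ≠ (s, t)) :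
    IsDirectedSection P a δ' d i j := by
  rw [hp.isDirectedSection_iff hd] at hij
  obtain ⟨⟨m, hm⟩, hst⟩ := hij
  obtain ⟨z, hz⟩ := h.isStep hm hne
  rw [hp'.isDirectedSection_iff hd]
  refine ⟨⟨m + z, ?_⟩, fun hi => hst (h.symm.isStable hi)⟩
  convert hz using 1
  ring

theorem isSection_iff (h : IsHeightShift P a δ δ' s t c) (hp : IsHeightPath P a δ)
    (hp' : IsHeightPath P a δ') {i j : ℕ} (hne : (i, j) ≠ (s, t)) (T : SectionKind) :
    IsSection P a δ' T i j ↔ IsSection P a δ T i j := by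
  cases T
  · exact ⟨fun e => h.symm.isDirectedSection hp' hp (Or.inl rfl) e hne,
      fun e => h.isDirectedSection hp hp' (Or.inl rfl) e hne⟩
  · exact ⟨fun e => h.symm.isDirectedSection hp' hp (Or.inr rfl) e hne,
      fun e => h.isDirectedSection hp hp' (Or.inr rfl) e hne⟩
  · exact ⟨fun e => h.symm.isStableSection e, fun e => h.isStableSection e⟩

end IsHeightShift

variable (P a) in
/-- The map applied at index `k` when a gallery is reflected in `H_{α,n}` between `s` and `t` and
translated by `c α^∨` from `t` on. -/
noncomputable def foldMap (s t : ℕ) (n c : ℤ) (k : ℕ) : N → N :=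
  if k < s then id
  else if k < t then affineReflection P a n
  else AffineEquiv.constVAdd ℝ N ((c : ℝ) • P.coroot a)

variable (P a) in
/-- The gallery obtained by reflecting `δ` in `H_{α,n}` between `s` and `t` and translating it by
`c α^∨` from `t` on. -/
noncomputable def foldOp (s t : ℕ) (n c : ℤ) (δ : GalleryData N) : GalleryData N where
  len := δ.len
  face k := foldMap P a s t n c k '' δ.face k
  alcove k := foldMap P a s t n c k '' δ.alcove k
  wt := δ.wt + (c : ℝ) • P.coroot a

/-- Both operators are instances of one construction that reverses a step from height `n` to `n -
c`: here `n = m_δ + 1`, `c = 1`; for `f_α`, `n = m_δ`, `c = -1`. -/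
theorem eOp_eq_foldOp (δ : GalleryData N) :
    eOp P a δ = foldOp P a (eStart P a δ) (eEnd P a δ) (minHeight P a δ + 1) 1 δ := by
  have h : eMap P a δ = foldMap P a (eStart P a δ) (eEnd P a δ) (minHeight P a δ + 1) 1 := by
    funext k
    have : (fun x : N => x + P.coroot a) =
        AffineEquiv.constVAdd ℝ N (((1 : ℤ) : ℝ) • P.coroot a) := by
      funext x
      simp [add_comm]
    rw [eMap, foldMap, this]
  simp [eOp, foldOp, h]

theorem fOp_eq_foldOp (δ : GalleryData N) :
    fOp P a δ = foldOp P a (fStart P a δ) (fEnd P a δ) (minHeight P a δ) (-1) δ := by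
  have h : fMap P a δ = foldMap P a (fStart P a δ) (fEnd P a δ) (minHeight P a δ) (-1) := by
    funext k
    have : (fun x : N => x - P.coroot a) =
        AffineEquiv.constVAdd ℝ N (((-1 : ℤ) : ℝ) • P.coroot a) := by
      funext x
      simp [sub_eq_add_neg, add_comm]
    rw [fMap, foldMap, this]
  simp [fOp, foldOp, h, sub_eq_add_neg]

theorem exists_foldMap_eq [P.IsCrystallographic] (s t : ℕ) (n c : ℤ) (k : ℕ) :
    ∃ g, IsApartmentAut P g ∧ foldMap P a s t n c k = g := by
  unfold foldMap
  split_ifs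
  · exact ⟨AffineEquiv.refl ℝ N, ⟨Equiv.refl ι, 0, by simp⟩, rfl⟩
  · exact ⟨_, isApartmentAut_affineReflection a n, rfl⟩
  · exact ⟨_, isApartmentAut_constVAdd a c, rfl⟩

theorem affineReflection_of_mem {n m : ℤ} {x : N} (hx : x ∈ hyperplane P a m) :
    affineReflection P a n x = x + ((n - m : ℤ) : ℝ) • P.coroot a := by
  have hx : P.root' a x = m := hx
  rw [affineReflection_apply, hx]
  push_cast
  module

variable {s t : ℕ} {n c : ℤ}

/-- This keeps the incidences of faces and alcoves where the map changes. The reflection in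
`H_{α,n}` fixes the face at `s`, and on `H_{α,n-c}`, which contains the face at `t`, it is the
translation by `c α^∨`. -/
theorem foldMap_succ_eqOn (h : IsStep P a δ s t n (n + -c)) (k : ℕ) :
    EqOn (foldMap P a s t n c (k + 1)) (foldMap P a s t n c k) (δ.face (k + 1)) := by
  intro x hx
  obtain ⟨h1, h2, h3, h4, -⟩ := h
  unfold foldMap
  by_cases e1 : k + 1 = s
  · subst e1
    rw [if_neg (by omega), if_pos h1, if_pos (by omega), affineReflection_of_mem (h3 hx)]
    simp
  by_cases e2 : k + 1 = t
  · subst e2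
    rw [if_neg (by omega), if_neg (by omega), if_neg (by omega), if_pos (by omega),
      affineReflection_of_mem (h4 hx)]
    simp [add_comm]
  · have i1 : k + 1 < s ↔ k < s := by omega
    have i2 : k + 1 < t ↔ k < t := by omega
    simp only [i1, i2]

theorem IsGallery.foldOp [Finite ι] [P.IsRootSystem] [P.IsCrystallographic] [P.IsReduced]
    [TopologicalSpace N] [IsTopologicalAddGroup N] [ContinuousSMul ℝ N] [T2Space N]
    {b : P.Base} (hδ : IsGallery b δ) (h : IsStep P a δ s t n (n + -c)) :
    IsGallery b (foldOp P a s t n c δ) where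
  face_zero := by
    change foldMap P a s t n c 0 '' δ.face 0 = {0}
    have h0 := h.2.2.1
    rw [hδ.face_zero, image_singleton]
    unfold foldMap
    by_cases e : 0 < s
    · rw [if_pos e]; rfl
    -- Here the origin itself is reflected, but it lies on the mirror.
    · obtain rfl : s = 0 := by omega
      rw [AtHeight, hδ.face_zero, singleton_subset_iff] at h0
      rw [if_neg e, if_pos h.1, affineReflection_of_mem h0]
      simp
  face_last := by
    change foldMap P a s t n c (δ.len + 1) '' δ.face (δ.len + 1) = {δ.wt + (c : ℝ) • P.coroot a}
    have h1 := h.1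
    have h2 := h.2.1
    rw [hδ.face_last, image_singleton, foldMap, if_neg (by omega), if_neg (by omega),
      AffineEquiv.constVAdd_apply, vadd_eq_add, add_comm]
  wt_mem := by
    change δ.wt + (c : ℝ) • P.coroot a ∈ cocharLattice P
    rw [Int.cast_smul_eq_zsmul]
    exact add_mem hδ.wt_mem (Submodule.smul_mem _ _ (Submodule.subset_span ⟨a, rfl⟩))
  isAlcove k hk := by
    obtain ⟨g, hg, e⟩ := exists_foldMap_eq (P := P) (a := a) s t n c k
    change IsAlcove b (foldMap P a s t n c k '' δ.alcove k)
    rw [e]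
    exact (hδ.isAlcove k hk).image hg
  face_subset k hk := image_mono (hδ.face_subset k hk)
  face_succ_subset k hk := by
    change foldMap P a s t n c (k + 1) '' δ.face (k + 1) ⊆ _
    rw [(foldMap_succ_eqOn h k).image_eq]
    exact image_mono (hδ.face_succ_subset k hk)
  isFace k hk hk' := by
    obtain ⟨g, hg, e⟩ := exists_foldMap_eq (P := P) (a := a) s t n c k
    change IsFace b (foldMap P a s t n c k '' δ.face k) ∧
      HasCodimOne (foldMap P a s t n c k '' δ.face k)
    rw [e]
    exact ⟨(hδ.isFace k hk hk').1.image hg, (hδ.isFace k hk hk').2.image g⟩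

theorem atHeight_foldOp_above (hst : s < t) {k : ℕ} (hk : t ≤ k) (m : ℤ) :
    AtHeight P a (foldOp P a s t n c δ) k (m + 2 * c) ↔ AtHeight P a δ k m := by
  change foldMap P a s t n c k '' δ.face k ⊆ hyperplane P a (m + 2 * c) ↔ _
  rw [foldMap, if_neg (by omega), if_neg (by omega), image_subset_iff]
  refine forall₂_congr fun x _ => ?_
  change P.root' a ((c : ℝ) • P.coroot a + x) = ((m + 2 * c : ℤ) : ℝ) ↔ P.root' a x = m
  rw [map_add, map_smul, P.root'_coroot_eq_pairing, P.pairing_same]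
  push_cast
  rw [smul_eq_mul, mul_comm, add_comm, add_left_inj]

/-- The reflection sends height `m` to `2n - m`, but among the reflected faces only the one at `s`
has a height, namely the fixed value `n`. -/
theorem atHeight_foldOp_below (hp : IsHeightPath P a δ) (h : IsStep P a δ s t n (n + -c)) {k : ℕ}
    (hk : k < t) (m : ℤ) :
    AtHeight P a (foldOp P a s t n c δ) k m ↔ AtHeight P a δ k m := by
  change foldMap P a s t n c k '' δ.face k ⊆ hyperplane P a m ↔ _
  by_cases hks : k < s
  · rw [foldMap, if_pos hks, image_id]
  have key : AtHeight P a δ k (2 * n - m) ↔ AtHeight P a δ k m := by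
    rcases Nat.lt_or_ge s k with hsk | hsk
    · exact iff_of_false (h.2.2.2.2 k hsk hk _) (h.2.2.2.2 k hsk hk _)
    · obtain rfl : k = s := by omega
      have hs : k ≤ δ.len + 1 := hk.le.trans h.2.1
      constructor <;> intro e <;> have e' := hp.unique hs e h.2.2.1
      · obtain rfl : m = n := by omega
        exact h.2.2.1
      · obtain rfl : m = n := by omega
        convert h.2.2.1 using 1
        ring
  rw [← key, foldMap, if_neg hks, if_pos hk, image_subset_iff]
  refine forall₂_congr fun x _ => ?_
  change P.root' a (affineReflection P a n x) = (m : ℝ) ↔ P.root' a x = ((2 * n - m : ℤ) : ℝ)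
  rw [affineReflection_apply, map_sub, map_smul, P.root'_coroot_eq_pairing, P.pairing_same]
  push_cast
  rw [smul_eq_mul]
  constructor <;> intro e <;> linarith

theorem isStep_foldOp (hp : IsHeightPath P a δ) (h : IsStep P a δ s t n (n + -c)) :
    IsStep P a (foldOp P a s t n c δ) s t n (n + c) := by
  refine ⟨h.1, h.2.1, (atHeight_foldOp_below hp h h.1 n).2 h.2.2.1, ?_, fun k hk hk' z hz =>
    h.2.2.2.2 k hk hk' z ((atHeight_foldOp_below hp h hk' z).1 hz)⟩
  have := (atHeight_foldOp_above (n := n) (c := c) h.1 le_rfl (n + -c)).2 h.2.2.2.1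
  convert this using 1
  ring

theorem isHeightShift_foldOp (hp : IsHeightPath P a δ) (h : IsStep P a δ s t n (n + -c))
    (h1 : ¬ IsStable P a δ s) (h2 : ¬ IsStable P a (foldOp P a s t n c δ) s) :
    IsHeightShift P a δ (foldOp P a s t n c δ) s t (2 * c) where
  len_eq := rfl
  step := ⟨_, _, h⟩
  step' := ⟨_, _, isStep_foldOp hp h⟩
  below _ hk m := atHeight_foldOp_below hp h hk m
  above _ hk _ m := atHeight_foldOp_above h.1 hk m
  not_stable := h1
  not_stable' := h2

end Folding

/-! ### The root operators and the directed sections. -/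

section Operators

variable {ι M N : Type*} [AddCommGroup M] [Module ℝ M] [AddCommGroup N] [Module ℝ N]
variable {P : RootPairing ι ℝ M N} {a : ι} {δ : GalleryData N}

namespace IsHeightPath

/-- Before the `(-α)`-directed section `[i, j]` no height is smaller than that of `i`. -/
theorem le_of_antidirected (hp : IsHeightPath P a δ) {i j : ℕ} {x : ℤ}
    (h : IsStep P a δ i j x (x + -1)) (hst : ¬ IsStable P a δ i) {k : ℕ} {z : ℤ} (hk : k ≤ i)
    (hz : AtHeight P a δ k z) : x ≤ z := by
  by_contra! hlt
  obtain ⟨h1, h2, h3, h4, h5⟩ := h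
  obtain ⟨k', hk1, hk2, hk3⟩ := hp.exists_between_up (m := x + -1) hk (by omega) hz h3
    (by omega) (by omega)
  -- The last index of height `x - 1` before `i` pairs with `j` to make the alcove `i` stable: a
  -- height `x - 2` in between would have to rise through `x - 1` once more.
  have hb : BddAbove {l | l ≤ i ∧ AtHeight P a δ l (x + -1)} := ⟨i, fun l hl => hl.1⟩
  obtain ⟨hl1, hl2⟩ := Nat.sSup_mem (s := {l | l ≤ i ∧ AtHeight P a δ l (x + -1)})
    ⟨k', hk2, hk3⟩ hb
  refine hst ⟨x + -1, _, j, hl1, h1, h2, h4, hl2, fun s hs hs' hA => ?_⟩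
  rcases Nat.lt_or_ge i s with hi | hi
  · exact h5 s hi hs' _ hA
  · obtain ⟨u, hu1, hu2, hu3⟩ := hp.exists_between_up (m := x + -1) hi (by omega) hA h3
      (by omega) (by omega)
    have hu4 := le_csSup hb (show u ∈ {l | l ≤ i ∧ AtHeight P a δ l (x + -1)} from ⟨hu2, hu3⟩)
    obtain rfl : s = u := by omega
    have := hp.unique (by omega) hA hu3
    omega

/-- From the `α`-directed section `[i, j]` on no height is smaller than that of `j`. -/
theorem le_of_directed (hp : IsHeightPath P a δ) {i j : ℕ} {x : ℤ}
    (h : IsStep P a δ i j x (x + 1)) (hst : ¬ IsStable P a δ i) {k : ℕ} {z : ℤ} (hk : j ≤ k)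
    (hkn : k ≤ δ.len + 1) (hz : AtHeight P a δ k z) : x + 1 ≤ z := by
  by_contra! hlt
  obtain ⟨h1, h2, h3, h4, h5⟩ := h
  obtain ⟨k', hk1, hk2, hk3⟩ := hp.exists_between_down (m := x) hk hkn h4 hz
    (by omega) (by omega)
  -- The first return to `x` after `j` pairs with `i` to make the alcove `i` stable: reaching `x -
  -- 1` sooner would mean passing `x` sooner.
  obtain ⟨hl1, hl2, hl3⟩ := Nat.sInf_mem (s := {r | j ≤ r ∧ r ≤ δ.len + 1 ∧ AtHeight P a δ r x})
    ⟨k', hk1, by omega, hk3⟩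
  refine hst ⟨x, i, _, le_rfl, by omega, hl2, hl3, h3, fun s hs hs' hA => ?_⟩
  rcases hs.eq_or_lt with rfl | hi
  · have := hp.unique (by omega) hA h3
    omega
  rcases Nat.lt_or_ge s j with hj | hj
  · exact h5 s hi hj _ hA
  · obtain ⟨u, hu1, hu2, hu3⟩ := hp.exists_between_down (m := x) hj (by omega) h4 hA
      (by omega) (by omega)
    have hu4 := Nat.sInf_le (show u ∈ {r | j ≤ r ∧ r ≤ δ.len + 1 ∧ AtHeight P a δ r x} from
      ⟨hu1, by omega, hu3⟩)
    omega

/-- The indices between which `e_α` reflects. -/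
theorem eStart_eEnd_spec (hp : IsHeightPath P a δ) (he : EDefined P a δ) :
    IsStep P a δ (eStart P a δ) (eEnd P a δ) (minHeight P a δ + 1)
      (minHeight P a δ + 1 + -1) ∧
    ∀ k < eEnd P a δ, ∀ m, AtHeight P a δ k m → minHeight P a δ + 1 ≤ m := by
  have he : minHeight P a δ ≤ -1 := he
  have hmin := fun k m hk h => hp.minHeight_le (k := k) (m := m) hk h
  obtain ⟨⟨k₀, hk₀, hk₀'⟩, -⟩ := hp.isLeast_minHeight
  obtain ⟨ht, ht'⟩ : eEnd P a δ ≤ δ.len + 1 ∧ AtHeight P a δ (eEnd P a δ) (minHeight P a δ) :=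
    Nat.sInf_mem (s := {k | k ≤ δ.len + 1 ∧ AtHeight P a δ k (minHeight P a δ)}) ⟨k₀, hk₀, hk₀'⟩
  have hlow : ∀ k < eEnd P a δ, ∀ m, AtHeight P a δ k m → minHeight P a δ + 1 ≤ m := by
    intro k hk m hm
    have h1 := hmin k m (by omega) hm
    have h2 : minHeight P a δ ≠ m := by
      rintro rfl
      exact absurd (Nat.sInf_le (s := {k | k ≤ δ.len + 1 ∧ AtHeight P a δ k (minHeight P a δ)})
        ⟨by omega, hm⟩) (not_le.2 hk)
    omega
  have hb : BddAbove {k | k ≤ eEnd P a δ ∧ AtHeight P a δ k (minHeight P a δ + 1)} :=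
    ⟨_, fun k hk => hk.1⟩
  -- Since `m_δ ≤ -1`, the descent from the initial height `0` passes `m_δ + 1`.
  obtain ⟨k₁, -, hk₁, hk₁'⟩ := hp.exists_between_down (m := minHeight P a δ + 1)
    (Nat.zero_le _) ht hp.zero ht' (by omega) (by omega)
  obtain ⟨hs, hs'⟩ : eStart P a δ ≤ eEnd P a δ ∧
      AtHeight P a δ (eStart P a δ) (minHeight P a δ + 1) :=
    Nat.sSup_mem (s := {k | k ≤ eEnd P a δ ∧ AtHeight P a δ k (minHeight P a δ + 1)})
      ⟨k₁, hk₁, hk₁'⟩ hb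
  have hne : eStart P a δ ≠ eEnd P a δ := by
    intro h
    rw [h] at hs'
    have := hp.unique ht hs' ht'
    omega
  refine ⟨⟨by omega, ht, hs', by rwa [add_neg_cancel_right], fun k hk hk' z hz => ?_⟩, hlow⟩
  have h1 := hlow k hk' z hz
  obtain ⟨u, hu1, hu2, hu3⟩ := hp.exists_between_down (m := minHeight P a δ + 1) hk'.le ht hz ht'
    (by omega) (by omega)
  have := le_csSup hb
    (show u ∈ {k | k ≤ eEnd P a δ ∧ AtHeight P a δ k (minHeight P a δ + 1)} from ⟨hu2, hu3⟩)
  exact absurd this (not_le.2 (hk.trans_le hu1))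

/-- The indices between which `f_α` reflects. -/
theorem fStart_fEnd_spec (hp : IsHeightPath P a δ) (hf : FDefined P a δ) :
    IsStep P a δ (fStart P a δ) (fEnd P a δ) (minHeight P a δ) (minHeight P a δ + - -1) ∧
    ∀ k, fStart P a δ < k → k ≤ δ.len + 1 → ∀ m, AtHeight P a δ k m →
      minHeight P a δ + 1 ≤ m := by
  have hf : (1 : ℝ) ≤ P.root' a δ.wt - minHeight P a δ := hf
  rw [← hp.wt_int] at hf
  have hf : 1 ≤ ⌊P.root' a δ.wt⌋ - minHeight P a δ := by exact_mod_cast hf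
  have hmin := fun k m hk h => hp.minHeight_le (k := k) (m := m) hk h
  obtain ⟨⟨k₀, hk₀, hk₀'⟩, -⟩ := hp.isLeast_minHeight
  have hb : BddAbove {k | k ≤ δ.len + 1 ∧ AtHeight P a δ k (minHeight P a δ)} :=
    ⟨_, fun k hk => hk.1⟩
  obtain ⟨hs, hs'⟩ : fStart P a δ ≤ δ.len + 1 ∧
      AtHeight P a δ (fStart P a δ) (minHeight P a δ) :=
    Nat.sSup_mem (s := {k | k ≤ δ.len + 1 ∧ AtHeight P a δ k (minHeight P a δ)})
      ⟨k₀, hk₀, hk₀'⟩ hb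
  have hlow : ∀ k, fStart P a δ < k → k ≤ δ.len + 1 → ∀ m, AtHeight P a δ k m →
      minHeight P a δ + 1 ≤ m := by
    intro k hk hkn m hm
    have h1 := hmin k m hkn hm
    have h2 : minHeight P a δ ≠ m := by
      rintro rfl
      exact absurd (le_csSup hb (show k ∈ {k | k ≤ δ.len + 1 ∧
        AtHeight P a δ k (minHeight P a δ)} from ⟨hkn, hm⟩)) (not_le.2 hk)
    omega
  obtain ⟨k₁, hk₁, hk₁n, hk₁'⟩ := hp.exists_between_up (m := minHeight P a δ + 1) hs le_rfl hs'
    hp.last (by omega) (by omega)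
  obtain ⟨ht, htn, ht'⟩ : fStart P a δ ≤ fEnd P a δ ∧ fEnd P a δ ≤ δ.len + 1 ∧
      AtHeight P a δ (fEnd P a δ) (minHeight P a δ + 1) :=
    Nat.sInf_mem (s := {k | fStart P a δ ≤ k ∧ k ≤ δ.len + 1 ∧
      AtHeight P a δ k (minHeight P a δ + 1)}) ⟨k₁, hk₁, hk₁n, hk₁'⟩
  have hne : fStart P a δ ≠ fEnd P a δ := by
    intro h
    rw [← h] at ht'
    have := hp.unique hs hs' ht'
    omega
  refine ⟨⟨by omega, htn, hs', by rwa [neg_neg], fun k hk hk' z hz => ?_⟩, hlow⟩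
  have h1 := hlow k hk (by omega) z hz
  obtain ⟨u, hu1, hu2, hu3⟩ := hp.exists_between_up (m := minHeight P a δ + 1) hk.le
    (by omega) hs' hz (by omega) (by omega)
  have : fEnd P a δ ≤ u := Nat.sInf_le (s := {k | fStart P a δ ≤ k ∧ k ≤ δ.len + 1 ∧
    AtHeight P a δ k (minHeight P a δ + 1)}) ⟨hu1, by omega, hu3⟩
  omega

/-- An interval witnessing stability at `eStart` contains the whole step, so its level is at most
each end height. In `δ` that bound is `m_δ`, but its left end has height at least `m_δ + 1`. In `e_α
δ` the bound is `m_δ + 1`, but its right end, raised by `2`, has height at least `m_δ + 2`. -/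
theorem isHeightShift_eOp (hp : IsHeightPath P a δ) (he : EDefined P a δ)
    (hp' : IsHeightPath P a (eOp P a δ)) :
    IsHeightShift P a δ (eOp P a δ) (eStart P a δ) (eEnd P a δ) 2 := by
  obtain ⟨h, hlow⟩ := hp.eStart_eEnd_spec he
  rw [eOp_eq_foldOp] at hp' ⊢
  refine isHeightShift_foldOp hp h ?_ ?_
  · rintro ⟨m, l, r, w⟩
    obtain ⟨hl, hr⟩ := h.of_stableWitness le_rfl h.1 w
    have h1 := hp.le_of_stableWitness w (hl.trans h.1.le) hr h.2.2.2.1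
    have h2 := hlow l (hl.trans_lt h.1) m w.2.2.2.2.1
    omega
  · rintro ⟨m, l, r, w⟩
    have h' := isStep_foldOp hp h
    obtain ⟨hl, hr⟩ := h'.of_stableWitness le_rfl h'.1 w
    have h1 := hp'.le_of_stableWitness w hl (h'.1.le.trans hr) h'.2.2.1
    have h2 := (atHeight_foldOp_above h.1 hr (m - 2 * 1)).1
      (by rw [sub_add_cancel]; exact w.2.2.2.1)
    have h3 := hp.minHeight_le w.2.2.1 h2
    omega

/-- Now the level is at most `m_δ` in `δ`, while the right end has height at least `m_δ + 1`. In
`f_α δ` it is at most `m_δ - 1`, while the left end keeps a height of at least `m_δ`. -/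
theorem isHeightShift_fOp (hp : IsHeightPath P a δ) (hf : FDefined P a δ)
    (hp' : IsHeightPath P a (fOp P a δ)) :
    IsHeightShift P a δ (fOp P a δ) (fStart P a δ) (fEnd P a δ) (-2) := by
  obtain ⟨h, hlow⟩ := hp.fStart_fEnd_spec hf
  rw [fOp_eq_foldOp] at hp' ⊢
  refine isHeightShift_foldOp hp h ?_ ?_
  · rintro ⟨m, l, r, w⟩
    obtain ⟨hl, hr⟩ := h.of_stableWitness le_rfl h.1 w
    have h1 := hp.le_of_stableWitness w hl (h.1.le.trans hr) h.2.2.1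
    have h2 := hlow r (h.1.trans_le hr) w.2.2.1 m w.2.2.2.1
    omega
  · rintro ⟨m, l, r, w⟩
    have h' := isStep_foldOp hp h
    obtain ⟨hl, hr⟩ := h'.of_stableWitness le_rfl h'.1 w
    have h1 := hp'.le_of_stableWitness w (hl.trans h'.1.le) hr h'.2.2.2.1
    have h2 := (atHeight_foldOp_below hp h (hl.trans_lt h'.1) m).1 w.2.2.2.2.1
    have hlen : l ≤ δ.len + 1 := hl.trans (h.1.le.trans h.2.1)
    have h3 := hp.minHeight_le hlen h2
    omega

theorem isSection_eStart_eEnd (hp : IsHeightPath P a δ) (he : EDefined P a δ)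
    (hp' : IsHeightPath P a (eOp P a δ)) :
    IsSection P a δ .antidirected (eStart P a δ) (eEnd P a δ) ∧
      IsSection P a (eOp P a δ) .directed (eStart P a δ) (eEnd P a δ) := by
  have hsh := hp.isHeightShift_eOp he hp'
  obtain ⟨h, -⟩ := hp.eStart_eEnd_spec he
  refine ⟨(hp.isDirectedSection_iff (Or.inr rfl)).2 ⟨⟨_, h⟩, hsh.not_stable⟩,
    (hp'.isDirectedSection_iff (Or.inl rfl)).2 ⟨⟨minHeight P a δ + 1, ?_⟩, hsh.not_stable'⟩⟩
  rw [eOp_eq_foldOp]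
  exact isStep_foldOp hp h

theorem isSection_fStart_fEnd (hp : IsHeightPath P a δ) (hf : FDefined P a δ)
    (hp' : IsHeightPath P a (fOp P a δ)) :
    IsSection P a δ .directed (fStart P a δ) (fEnd P a δ) ∧
      IsSection P a (fOp P a δ) .antidirected (fStart P a δ) (fEnd P a δ) := by
  have hsh := hp.isHeightShift_fOp hf hp'
  obtain ⟨h, -⟩ := hp.fStart_fEnd_spec hf
  refine ⟨(hp.isDirectedSection_iff (Or.inl rfl)).2 ⟨⟨minHeight P a δ, ?_⟩, hsh.not_stable⟩,
    (hp'.isDirectedSection_iff (Or.inr rfl)).2 ⟨⟨minHeight P a δ, ?_⟩, hsh.not_stable'⟩⟩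
  · rwa [neg_neg] at h
  · rw [fOp_eq_foldOp]
    exact isStep_foldOp hp h

/-- A `(-α)`-directed section starting after the minimum is reached would start at height at most
`m_δ` and then descend below the minimum. -/
theorem le_eStart (hp : IsHeightPath P a δ) (he : EDefined P a δ) {i j : ℕ}
    (hij : IsSection P a δ .antidirected i j) : i ≤ eStart P a δ := by
  obtain ⟨⟨x, h⟩, hst⟩ := (hp.isDirectedSection_iff (Or.inr rfl)).1 hij
  obtain ⟨h', -⟩ := hp.eStart_eEnd_spec he
  refine (h'.le_or_le h.2.2.1).resolve_right fun hle => ?_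
  have h1 := hp.le_of_antidirected h hst hle h'.2.2.2.1
  have h2 := hp.minHeight_le h.2.1 h.2.2.2.1
  omega

theorem fStart_le (hp : IsHeightPath P a δ) (hf : FDefined P a δ) {i j : ℕ}
    (hij : IsSection P a δ .directed i j) : fStart P a δ ≤ i := by
  obtain ⟨⟨x, h⟩, hst⟩ := (hp.isDirectedSection_iff (Or.inl rfl)).1 hij
  obtain ⟨h', -⟩ := hp.fStart_fEnd_spec hf
  refine (h.le_or_le h'.2.2.1).resolve_right fun hle => ?_
  have h1 := hp.le_of_directed h hst hle (h'.1.le.trans h'.2.1) h'.2.2.1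
  have h2 := hp.minHeight_le (h.1.le.trans h.2.1) h.2.2.1
  omega

theorem eDefined_of_isSection (hp : IsHeightPath P a δ) {i j : ℕ}
    (hij : IsSection P a δ .antidirected i j) : EDefined P a δ := by
  obtain ⟨⟨x, h⟩, hst⟩ := (hp.isDirectedSection_iff (Or.inr rfl)).1 hij
  have h1 := hp.le_of_antidirected h hst (Nat.zero_le i) hp.zero
  have h2 := hp.minHeight_le h.2.1 h.2.2.2.1
  change minHeight P a δ ≤ -1
  omega

theorem fDefined_of_isSection (hp : IsHeightPath P a δ) {i j : ℕ}
    (hij : IsSection P a δ .directed i j) : FDefined P a δ := by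
  obtain ⟨⟨x, h⟩, hst⟩ := (hp.isDirectedSection_iff (Or.inl rfl)).1 hij
  have h1 := hp.le_of_directed h hst h.2.1 le_rfl hp.last
  have h2 := hp.minHeight_le (h.1.le.trans h.2.1) h.2.2.1
  change (1 : ℝ) ≤ P.root' a δ.wt - minHeight P a δ
  rw [← hp.wt_int]
  have : 1 ≤ ⌊P.root' a δ.wt⌋ - minHeight P a δ := by omega
  exact_mod_cast this

theorem finite_sections (hp : IsHeightPath P a δ) (T : SectionKind) :
    {q : ℕ × ℕ | IsSection P a δ T q.1 q.2}.Finite := by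
  refine ((finite_Iic (δ.len + 1)).prod (finite_Iic (δ.len + 1))).subset ?_
  rintro ⟨i, j⟩ h
  obtain ⟨h1, h2⟩ := hp.isSection_lt h
  exact ⟨h1.le.trans h2, h2⟩

/-- Expressing the count without the partition allows an induction in which the gallery changes. -/
theorem sectionCount_eq (hp : IsHeightPath P a δ) {S : Finset ℕ}
    (hS : IsSectionPartition P a δ S) (T : SectionKind) :
    sectionCount P a δ S T = {q : ℕ × ℕ | IsSection P a δ T q.1 q.2}.ncard := by
  unfold sectionCount
  congr 1
  ext ⟨i, j⟩
  exact ⟨fun h => h.2, fun h => ⟨(hp.isConsecutive_iff hS).2 ⟨T, h⟩, h⟩⟩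

end IsHeightPath

/-- Between `δ` and `δ'` only the kind of the section `[s, t]` changes. -/
theorem IsHeightShift.sections_eq {δ' : GalleryData N} {s t : ℕ} {c : ℤ}
    (h : IsHeightShift P a δ δ' s t c) (hp : IsHeightPath P a δ) (hp' : IsHeightPath P a δ')
    {T T' : SectionKind} (hT' : IsSection P a δ' T' s t) (hne : T ≠ T') :
    {q : ℕ × ℕ | IsSection P a δ' T q.1 q.2} =
      {q : ℕ × ℕ | IsSection P a δ T q.1 q.2} \ {(s, t)} := by
  ext ⟨i, j⟩
  by_cases he : (i, j) = (s, t)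
  · obtain ⟨rfl, rfl⟩ := Prod.mk.inj he
    refine iff_of_false (fun h1 => hne ?_) fun h1 => h1.2 rfl
    have hlt := (hp'.isSection_lt hT').1
    exact (hp'.isSection_eq_of_overlap h1 hT' le_rfl hlt le_rfl hlt).2.2
  · exact (h.isSection_iff hp hp' he T).trans (and_iff_left he).symm

/-- A partition of `δ` remains one if only the kind of the section `[s, t]` changes. -/
theorem IsHeightShift.isSectionPartition {δ' : GalleryData N} {s t : ℕ} {c : ℤ}
    (h : IsHeightShift P a δ δ' s t c) (hp : IsHeightPath P a δ) (hp' : IsHeightPath P a δ')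
    {T' : SectionKind} (hT' : IsSection P a δ' T' s t) {S : Finset ℕ}
    (hS : IsSectionPartition P a δ S) : IsSectionPartition P a δ' S := by
  obtain ⟨h0, hn, hle, hsec⟩ := hS
  have hlen := h.len_eq
  refine ⟨h0, by rwa [hlen], by rwa [hlen], fun i j hij => ?_⟩
  by_cases he : (i, j) = (s, t)
  · obtain ⟨rfl, rfl⟩ := Prod.mk.inj he
    exact ⟨T', hT'⟩
  · obtain ⟨T, hT⟩ := hsec i j hij
    exact ⟨T, (h.isSection_iff hp hp' he T).2 hT⟩

variable [Finite ι] [P.IsRootSystem] [P.IsCrystallographic] [P.IsReduced]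
  [TopologicalSpace N] [IsTopologicalAddGroup N] [ContinuousSMul ℝ N] [T2Space N] {b : P.Base}

theorem IsGallery.eOp (hδ : IsGallery b δ) (ha : b.IsPos a) (he : EDefined P a δ) :
    IsGallery b (eOp P a δ) := by
  rw [eOp_eq_foldOp]
  exact hδ.foldOp ((hδ.isHeightPath ha).eStart_eEnd_spec he).1

theorem IsGallery.fOp (hδ : IsGallery b δ) (ha : b.IsPos a) (hf : FDefined P a δ) :
    IsGallery b (fOp P a δ) := by
  rw [fOp_eq_foldOp]
  exact hδ.foldOp ((hδ.isHeightPath ha).fStart_fEnd_spec hf).1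

/-- `e_α` can be applied exactly as often as there are `(-α)`-directed sections. -/
theorem isGreatest_eIterDefined (hδ : IsGallery b δ) (ha : b.IsPos a) :
    IsGreatest {n | EIterDefined P a n δ}
      {q : ℕ × ℕ | IsSection P a δ .antidirected q.1 q.2}.ncard := by
  -- Each application of `e_α` removes exactly one such section, and it is applicable exactly when
  -- one exists.
  induction h : {q : ℕ × ℕ | IsSection P a δ .antidirected q.1 q.2}.ncard generalizing δ with
  | zero =>
    have hp := hδ.isHeightPath ha
    refine ⟨trivial, fun n hn => ?_⟩
    rcases n with _ | n
    · exact le_rfl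
    · have hs := hp.isSection_eStart_eEnd hn.1 ((hδ.eOp ha hn.1).isHeightPath ha)
      rw [ncard_eq_zero (hp.finite_sections _)] at h
      exact absurd (show (eStart P a δ, eEnd P a δ) ∈ _ from hs.1) (h ▸ notMem_empty _)
  | succ n ih =>
    have hp := hδ.isHeightPath ha
    obtain ⟨q, hq⟩ := nonempty_of_ncard_ne_zero (by rw [h]; omega)
    have he := hp.eDefined_of_isSection hq
    have hp' := (hδ.eOp ha he).isHeightPath ha
    obtain ⟨h1, h2⟩ := hp.isSection_eStart_eEnd he hp'
    have hIH := ih (hδ.eOp ha he) (by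
      rw [(hp.isHeightShift_eOp he hp').sections_eq hp hp' h2
          (T := .antidirected) nofun,
        ncard_sdiff_singleton_of_mem
          (show (eStart P a δ, eEnd P a δ) ∈
            {q : ℕ × ℕ | IsSection P a δ .antidirected q.1 q.2} from h1), h]
      rfl)
    refine ⟨⟨he, hIH.1⟩, fun k hk => ?_⟩
    rcases k with _ | k
    · omega
    · exact Nat.succ_le_succ (hIH.2 hk.2)

/-- `f_α` can be applied exactly as often as there are `α`-directed sections. -/
theorem isGreatest_fIterDefined (hδ : IsGallery b δ) (ha : b.IsPos a) :
    IsGreatest {n | FIterDefined P a n δ}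
      {q : ℕ × ℕ | IsSection P a δ .directed q.1 q.2}.ncard := by
  induction h : {q : ℕ × ℕ | IsSection P a δ .directed q.1 q.2}.ncard generalizing δ with
  | zero =>
    have hp := hδ.isHeightPath ha
    refine ⟨trivial, fun n hn => ?_⟩
    rcases n with _ | n
    · exact le_rfl
    · have hs := hp.isSection_fStart_fEnd hn.1 ((hδ.fOp ha hn.1).isHeightPath ha)
      rw [ncard_eq_zero (hp.finite_sections _)] at h
      exact absurd (show (fStart P a δ, fEnd P a δ) ∈ _ from hs.1) (h ▸ notMem_empty _)
  | succ n ih =>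
    have hp := hδ.isHeightPath ha
    obtain ⟨q, hq⟩ := nonempty_of_ncard_ne_zero (by rw [h]; omega)
    have hf := hp.fDefined_of_isSection hq
    have hp' := (hδ.fOp ha hf).isHeightPath ha
    obtain ⟨h1, h2⟩ := hp.isSection_fStart_fEnd hf hp'
    have hIH := ih (hδ.fOp ha hf) (by
      rw [(hp.isHeightShift_fOp hf hp').sections_eq hp hp' h2
          (T := .directed) nofun,
        ncard_sdiff_singleton_of_mem
          (show (fStart P a δ, fEnd P a δ) ∈
            {q : ℕ × ℕ | IsSection P a δ .directed q.1 q.2} from h1), h]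
      rfl)
    refine ⟨⟨hf, hIH.1⟩, fun k hk => ?_⟩
    rcases k with _ | k
    · omega
    · exact Nat.succ_le_succ (hIH.2 hk.2)

end Operators

end LSGallery

/-! ### The theorem, assembled from the results on height paths. -/

theorem mainTheorem6 {ι M N : Type*} [Finite ι] [AddCommGroup M] [Module ℝ M]
    [AddCommGroup N] [Module ℝ N] [TopologicalSpace N] [IsTopologicalAddGroup N]
    [ContinuousSMul ℝ N] [T2Space N]
    (P : RootPairing ι ℝ M N) [P.IsRootSystem] [P.IsCrystallographic] [P.IsReduced]
    (b : P.Base) (lam : N) (hlam : LSGallery.IsDominant b lam)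
    (γ δ : LSGallery.GalleryData N) (hγ : LSGallery.IsMinimalGallery b lam γ)
    (hδ : LSGallery.IsLSGallery b lam γ δ) (a : ι) (ha : a ∈ b.support) :
    ∃ S : Finset ℕ,
      -- `S` is the unique partition of `δ` into sections, each of exactly one kind
      LSGallery.IsSectionPartition P a δ S ∧
      (∀ S', LSGallery.IsSectionPartition P a δ S' → S' = S) ∧
      (∀ i j, LSGallery.IsConsecutive S i j → ∃! T, LSGallery.IsSection P a δ T i j) ∧
      -- the operator `e_α`
      (LSGallery.EDefined P a δ →
        ∃ i j, LSGallery.IsConsecutive S i j ∧ LSGallery.IsSection P a δ .antidirected i j ∧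
          (∀ i' j', LSGallery.IsConsecutive S i' j' →
            LSGallery.IsSection P a δ .antidirected i' j' → i' ≤ i) ∧
          LSGallery.IsGallery b (LSGallery.eOp P a δ) ∧
          LSGallery.IsSectionPartition P a (LSGallery.eOp P a δ) S ∧
          (∀ S', LSGallery.IsSectionPartition P a (LSGallery.eOp P a δ) S' → S' = S) ∧
          (∀ T, LSGallery.IsSection P a (LSGallery.eOp P a δ) T i j ↔ T = .directed) ∧
          (∀ i' j', LSGallery.IsConsecutive S i' j' → (i', j') ≠ (i, j) →
            ∀ T, LSGallery.IsSection P a (LSGallery.eOp P a δ) T i' j' ↔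
              LSGallery.IsSection P a δ T i' j') ∧
          δ.face j ⊆ LSGallery.hyperplane P a (LSGallery.minHeight P a δ) ∧
          ∀ k ≤ δ.len,
            (k < i → (LSGallery.eOp P a δ).alcove k = δ.alcove k) ∧
            (i ≤ k → k < j → (LSGallery.eOp P a δ).alcove k =
              LSGallery.affineReflection P a (LSGallery.minHeight P a δ + 1) '' δ.alcove k) ∧
            (j ≤ k → (LSGallery.eOp P a δ).alcove k =
              (fun x => x + P.coroot a) '' δ.alcove k)) ∧
      IsGreatest {n | LSGallery.EIterDefined P a n δ}
        (LSGallery.sectionCount P a δ S .antidirected) ∧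
      -- the operator `f_α`
      (LSGallery.FDefined P a δ →
        ∃ i j, LSGallery.IsConsecutive S i j ∧ LSGallery.IsSection P a δ .directed i j ∧
          (∀ i' j', LSGallery.IsConsecutive S i' j' →
            LSGallery.IsSection P a δ .directed i' j' → i ≤ i') ∧
          LSGallery.IsGallery b (LSGallery.fOp P a δ) ∧
          LSGallery.IsSectionPartition P a (LSGallery.fOp P a δ) S ∧
          (∀ S', LSGallery.IsSectionPartition P a (LSGallery.fOp P a δ) S' → S' = S) ∧
          (∀ T, LSGallery.IsSection P a (LSGallery.fOp P a δ) T i j ↔ T = .antidirected) ∧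
          (∀ i' j', LSGallery.IsConsecutive S i' j' → (i', j') ≠ (i, j) →
            ∀ T, LSGallery.IsSection P a (LSGallery.fOp P a δ) T i' j' ↔
              LSGallery.IsSection P a δ T i' j') ∧
          δ.face i ⊆ LSGallery.hyperplane P a (LSGallery.minHeight P a δ) ∧
          ∀ k ≤ δ.len,
            (k < i → (LSGallery.fOp P a δ).alcove k = δ.alcove k) ∧
            (i ≤ k → k < j → (LSGallery.fOp P a δ).alcove k =
              LSGallery.affineReflection P a (LSGallery.minHeight P a δ) '' δ.alcove k) ∧
            (j ≤ k → (LSGallery.fOp P a δ).alcove k =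
              (fun x => x - P.coroot a) '' δ.alcove k)) ∧
      IsGreatest {n | LSGallery.FIterDefined P a n δ}
        (LSGallery.sectionCount P a δ S .directed) := by
  have hg := hδ.isGallery
  have ha' := RootPairing.Base.isPos_of_mem_support ha
  have hp := hg.isHeightPath ha'
  obtain ⟨S, hS, hSu⟩ := hp.existsUnique_partition
  refine ⟨S, hS, hSu, fun i j hij => ?_, fun he => ?_, ?_, fun hf => ?_, ?_⟩
  · obtain ⟨T, hT⟩ := hS.2.2.2 i j hij
    exact ⟨T, hT, fun T' hT' =>
      (hp.isSection_eq_of_overlap hT' hT le_rfl hij.2.2.1 le_rfl hij.2.2.1).2.2⟩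
  · have hg' := hg.eOp ha' he
    have hp' := hg'.isHeightPath ha'
    have hsh := hp.isHeightShift_eOp he hp'
    obtain ⟨h1, h2⟩ := hp.isSection_eStart_eEnd he hp'
    have hlt := (hp.isSection_lt h1).1
    have hS' := hsh.isSectionPartition hp hp' h2 hS
    refine ⟨LSGallery.eStart P a δ, LSGallery.eEnd P a δ, (hp.isConsecutive_iff hS).2 ⟨_, h1⟩, h1,
      fun i j _ h => hp.le_eStart he h, hg', hS',
      fun S' h => hp'.existsUnique_partition.unique h hS', fun T => ⟨fun hT => ?_, ?_⟩,
      fun i j _ hne T => hsh.isSection_iff hp hp' hne T, ?_, fun k _ => ⟨?_, ?_, ?_⟩⟩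
    · exact (hp'.isSection_eq_of_overlap hT h2 le_rfl hlt le_rfl hlt).2.2
    · rintro rfl
      exact h2
    · have := (hp.eStart_eEnd_spec he).1.2.2.2.1
      rwa [add_neg_cancel_right] at this
    · intro hk
      change LSGallery.eMap P a δ k '' δ.alcove k = _
      rw [LSGallery.eMap, if_pos hk, Set.image_id]
    · intro hk hk'
      change LSGallery.eMap P a δ k '' δ.alcove k = _
      rw [LSGallery.eMap, if_neg hk.not_gt, if_pos hk']
    · intro hk
      change LSGallery.eMap P a δ k '' δ.alcove k = _
      rw [LSGallery.eMap, if_neg (hlt.le.trans hk).not_gt, if_neg hk.not_gt]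
  · rw [hp.sectionCount_eq hS]
    exact LSGallery.isGreatest_eIterDefined hg ha'
  · have hg' := hg.fOp ha' hf
    have hp' := hg'.isHeightPath ha'
    have hsh := hp.isHeightShift_fOp hf hp'
    obtain ⟨h1, h2⟩ := hp.isSection_fStart_fEnd hf hp'
    have hlt := (hp.isSection_lt h1).1
    have hS' := hsh.isSectionPartition hp hp' h2 hS
    refine ⟨LSGallery.fStart P a δ, LSGallery.fEnd P a δ, (hp.isConsecutive_iff hS).2 ⟨_, h1⟩, h1,
      fun i j _ h => hp.fStart_le hf h, hg', hS',
      fun S' h => hp'.existsUnique_partition.unique h hS', fun T => ⟨fun hT => ?_, ?_⟩,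
      fun i j _ hne T => hsh.isSection_iff hp hp' hne T,
      (hp.fStart_fEnd_spec hf).1.2.2.1, fun k _ => ⟨?_, ?_, ?_⟩⟩
    · exact (hp'.isSection_eq_of_overlap hT h2 le_rfl hlt le_rfl hlt).2.2
    · rintro rfl
      exact h2
    · intro hk
      change LSGallery.fMap P a δ k '' δ.alcove k = _
      rw [LSGallery.fMap, if_pos hk, Set.image_id]
    · intro hk hk'
      change LSGallery.fMap P a δ k '' δ.alcove k = _
      rw [LSGallery.fMap, if_neg hk.not_gt, if_pos hk']
    · intro hk
      change LSGallery.fMap P a δ k '' δ.alcove k = _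
      rw [LSGallery.fMap, if_neg (hlt.le.trans hk).not_gt, if_neg hk.not_gt]
  · rw [hp.sectionCount_eq hS]
    exact LSGallery.isGreatest_fIterDefined hg ha'
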